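/- Let $d,k$ be integers with either $d=2$ and $k\ge 4$, or $d\ge 3$ and $k\ge 3$. Let $\mathbb{C}\langle\langle x_1,\dots,x_d\rangle\rangle$ be the ring of formal noncommutative power series, with two-sided maximal ideal $\mathfrak n$ of series with zero constant term, and let $f=\sum_i f_i$ be an element of order $k$, i.e. its homogeneous components satisfy $f_i=0$ for $i<k$ and $f_k\neq 0$. Let $\delta_i$ be the cyclic derivatives, that is, the continuous linear maps which send a monomial $x_{i_1}\cdots x_{i_t}$ to $\sum_{j=1}^t\partial_i(x_{i_j}\cdots x_{i_t}x_{i_1}\cdots x_{i_{j-1}})$, where $\partial_i(x_i n)=n$ and $\partial_i(m)=0$ if the monomial $m$ does not start with $x_i$. Let $$\mathrm{Jac}(f)=\mathbb{C}\langle\langle x_1,\dots,x_d\rangle\rangle\big/((\delta_1f,\dots,\delta_df))$$ be the Jacobi algebra, the quotient by the closure $\bigcap_{i\ge0}(I+\mathfrak n^i)$ of the two-sided ideal $I=(\delta_1f,\dots,\delta_df)$, and let $\mathfrak J$ be the Jacobson radical of $\mathrm{Jac}(f)$. Then: 1. The $\mathfrak J$-dimension of $\mathrm{Jac}(f)$,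 namely $$\inf\{r\in\mathbb R\mid \text{for some } c\in\mathbb R,\ \dim_{\mathbb C}\mathrm{Jac}(f)/\mathfrak J^n\le c\,n^r\text{ for every } n\in\mathbb N\}$$ (interpreted as $\infty$ if there is no such $r$), is at least $3$. 2. The Poincaré series $\sum_{n\ge0}\dim_{\mathbb C}\big(\mathrm{Jac}(f)/\mathfrak J^{n+1}\big)t^n$ is bounded below, coefficient by coefficient, by the power series expansion of $$\frac{1}{(1-t)(1-dt+dt^{k-1}-t^k)}.$$ -/

import Mathlib

/-- Formal noncommutative power series `ℂ⟪x₁, …, x_d⟫`: a series is the family of its coefficients,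
one for each word (noncommutative monomial) in the letters `Fin d`. -/
def NCPowerSeries (d : ℕ) : Type := List (Fin d) → ℂ

noncomputable section

namespace NCPowerSeries

variable {d : ℕ}

/-- The coefficient of the word `w` in `f`. -/
def coeff (w : List (Fin d)) (f : NCPowerSeries d) : ℂ := f w

/-- The series with prescribed coefficients. -/
def mk (c : List (Fin d) → ℂ) : NCPowerSeries d := c

@[simp] theorem coeff_mk (c : List (Fin d) → ℂ) (w : List (Fin d)) : coeff w (mk c) = c w := rfl

@[ext] theorem ext {f g : NCPowerSeries d} (h : ∀ w, coeff w f = coeff w g) : f = g := funext h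

instance : AddCommGroup (NCPowerSeries d) := inferInstanceAs (AddCommGroup (List (Fin d) → ℂ))

instance : Module ℂ (NCPowerSeries d) := inferInstanceAs (Module ℂ (List (Fin d) → ℂ))

@[simp] theorem coeff_zero (w : List (Fin d)) : coeff w (0 : NCPowerSeries d) = 0 := rfl

@[simp] theorem coeff_add (w : List (Fin d)) (f g : NCPowerSeries d) :
    coeff w (f + g) = coeff w f + coeff w g := rfl

@[simp] theorem coeff_smul (w : List (Fin d)) (a : ℂ) (f : NCPowerSeries d) :
    coeff w (a • f) = a * coeff w f := rfl

/-- The unit series `1`, supported on the empty word. -/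
instance : One (NCPowerSeries d) := ⟨mk fun w => if w = [] then 1 else 0⟩

/-- The product extending concatenation of words: the coefficient at `w` is the sum of
`(coefficient of f at u) * (coefficient of g at v)` over all factorisations `w = u v`. -/
instance : Mul (NCPowerSeries d) :=
  ⟨fun f g => mk fun w =>
    ∑ i ∈ Finset.range (w.length + 1), coeff (w.take i) f * coeff (w.drop i) g⟩

theorem coeff_one (w : List (Fin d)) :
    coeff w (1 : NCPowerSeries d) = if w = [] then 1 else 0 := rfl

theorem coeff_mul (w : List (Fin d)) (f g : NCPowerSeries d) :
    coeff w (f * g) =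
      ∑ i ∈ Finset.range (w.length + 1), coeff (w.take i) f * coeff (w.drop i) g := rfl

protected theorem one_mul' (f : NCPowerSeries d) : 1 * f = f := by
  ext w
  rw [coeff_mul, Finset.sum_eq_single 0]
  · simp [coeff_one]
  · intro i hi h0
    have : w.take i ≠ [] := by
      intro h
      rw [List.take_eq_nil_iff] at h
      rcases h with h | h
      · exact h0 h
      · subst h; simp at hi; exact h0 hi
    simp [coeff_one, this]
  · simp

protected theorem mul_one' (f : NCPowerSeries d) : f * 1 = f := by
  ext w
  rw [coeff_mul, Finset.sum_eq_single w.length]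
  · simp [coeff_one]
  · intro i hi h0
    have : w.drop i ≠ [] := by
      intro h
      rw [List.drop_eq_nil_iff] at h
      simp at hi
      omega
    simp [coeff_one, this]
  · simp

protected theorem mul_assoc' (f g h : NCPowerSeries d) : f * g * h = f * (g * h) := by
  ext w
  simp only [coeff_mul, Finset.sum_mul, Finset.mul_sum, Finset.sum_sigma']
  refine Finset.sum_bij' (fun p _ => ⟨p.2, p.1 - p.2⟩) (fun p _ => ⟨p.1 + p.2, p.1⟩)
    ?_ ?_ ?_ ?_ ?_
  · rintro ⟨i, j⟩ hp
    simp at hp ⊢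
    omega
  · rintro ⟨i, j⟩ hp
    simp at hp ⊢
    omega
  · rintro ⟨i, j⟩ hp
    simp at hp ⊢
    omega
  · rintro ⟨i, j⟩ hp
    simp
  · rintro ⟨i, j⟩ hp
    simp at hp
    have hji : j ≤ i := by omega
    simp only [List.take_take, List.drop_drop, List.drop_take, min_eq_left hji,
      Nat.add_sub_cancel' hji, mul_assoc]

instance : Ring (NCPowerSeries d) :=
  { (inferInstance : AddCommGroup (NCPowerSeries d)) with
    mul := (· * ·)
    one := 1
    mul_assoc := NCPowerSeries.mul_assoc'
    one_mul := NCPowerSeries.one_mul'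
    mul_one := NCPowerSeries.mul_one'
    left_distrib := fun f g h => by
      ext w; simp [coeff_mul, mul_add, Finset.sum_add_distrib]
    right_distrib := fun f g h => by
      ext w; simp [coeff_mul, add_mul, Finset.sum_add_distrib]
    zero_mul := fun f => by ext w; simp [coeff_mul]
    mul_zero := fun f => by ext w; simp [coeff_mul] }

instance : Algebra ℂ (NCPowerSeries d) :=
  Algebra.ofModule
    (fun a f g => by ext w; simp [coeff_mul, Finset.mul_sum, mul_assoc])
    (fun a f g => by ext w; simp [coeff_mul, Finset.mul_sum, mul_left_comm])

/-- The order of `f`: the least `i` such that the homogeneous component `f_i` is nonzero, i.e. such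
that some word of length `i` has a nonzero coefficient; the order of `0` is `⊤`. -/
def order (f : NCPowerSeries d) : ℕ∞ :=
  ⨅ (w : List (Fin d)) (_ : coeff w f ≠ 0), (w.length : ℕ∞)

/-- The two-sided maximal ideal `𝔫` of series with zero constant term. -/
def maxIdeal (d : ℕ) : Ideal (NCPowerSeries d) where
  carrier := {f | coeff [] f = 0}
  add_mem' := by
    intro f g hf hg
    simp only [Set.mem_ofPred_eq] at hf hg ⊢
    simp [hf, hg]
  zero_mem' := rfl
  smul_mem' := by
    intro f g hg
    simp only [Set.mem_ofPred_eq] at hg ⊢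
    simp [smul_eq_mul, coeff_mul, hg]

instance : (maxIdeal d).IsTwoSided :=
  ⟨fun {a} b ha => by
    have ha' : coeff [] a = 0 := ha
    change coeff [] (a * b) = 0
    simp [coeff_mul, ha']⟩

/-- Cyclic symmetrisation, the continuous linear map sending each monomial `m` of length `t` to the
sum of its `t` rotations. The number of `j < t` with `m.rotate j = w` equals the number of `j < t`
with `w.rotate j = m`, so the coefficient of the image at `w` is the following sum. -/
def sym (f : NCPowerSeries d) : NCPowerSeries d :=
  mk fun w => ∑ j ∈ Finset.range w.length, coeff (w.rotate j) f

/-- The strike-off derivative `∂ᵢ`, sending a monomial `xᵢ n` to `n` and every monomial that does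
not start with `xᵢ` to `0`. -/
def strikeOff (i : Fin d) (f : NCPowerSeries d) : NCPowerSeries d :=
  mk fun w => coeff (i :: w) f

/-- The cyclic derivative `δᵢ = ∂ᵢ ∘ sym`. -/
def cyclicDeriv (i : Fin d) (f : NCPowerSeries d) : NCPowerSeries d :=
  strikeOff i (sym f)

/-- The closure `⋂ᵢ (I + 𝔫ⁱ)` of an ideal in the `𝔫`-adic topology. -/
def idealClosure (I : Ideal (NCPowerSeries d)) : Ideal (NCPowerSeries d) :=
  ⨅ i : ℕ, I ⊔ maxIdeal d ^ i

instance (I : Ideal (NCPowerSeries d)) [I.IsTwoSided] : (idealClosure I).IsTwoSided :=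
  ⟨fun {a} b ha => by
    simp only [idealClosure, Submodule.mem_iInf] at ha ⊢
    intro i
    obtain ⟨x, hx, y, hy, rfl⟩ := Submodule.mem_sup.mp (ha i)
    rw [add_mul]
    exact Submodule.add_mem_sup (Ideal.mul_mem_right b _ hx) (Ideal.mul_mem_right b _ hy)⟩

/-- The closed two-sided ideal `((δ₁f, …, δ_d f))`. -/
def jacobiIdeal (f : NCPowerSeries d) : Ideal (NCPowerSeries d) :=
  idealClosure (TwoSidedIdeal.span (Set.range fun i : Fin d => cyclicDeriv i f)).asIdeal

instance (f : NCPowerSeries d) : (jacobiIdeal f).IsTwoSided :=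
  inferInstanceAs (idealClosure _).IsTwoSided

/-- The Jacobi algebra of `f`. -/
abbrev Jac (f : NCPowerSeries d) : Type := NCPowerSeries d ⧸ jacobiIdeal f

/-- The dimension over `ℂ` of `Jac(f) / 𝔍ⁿ`, where `𝔍` is the Jacobson radical of `Jac(f)`. -/
def jacDim (f : NCPowerSeries d) (n : ℕ) : ℕ :=
  Module.finrank ℂ (Jac f ⧸ (Ring.jacobson (Jac f) ^ n : Ideal (Jac f)))

/-- The `𝔍`-dimension of `Jac(f)`, for `f` of order at least two: the infimum of the real `r` such
that `dim Jac(f)/𝔍ⁿ ≤ c nʳ` for all `n`, for some real `c`; it is `⊤` if there is no such `r`. -/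
def Jdim (f : NCPowerSeries d) : EReal :=
  sInf ((fun r : ℝ => (r : EReal)) '' {r : ℝ | ∃ c : ℝ, ∀ n : ℕ, (jacDim f n : ℝ) ≤ c * (n : ℝ) ^ r})

/-- The Poincaré series of `Jac(f)`, with coefficient `dim Jac(f)/𝔍ⁿ⁺¹` at `tⁿ`. -/
def poincareSeries (f : NCPowerSeries d) : PowerSeries ℚ :=
  PowerSeries.mk fun n => (jacDim f (n + 1) : ℚ)

end NCPowerSeries

end

noncomputable section

namespace NCPowerSeries

variable {d : ℕ}

/-! Let `D n` be the dimension of the free algebra modulo the relations and the series of order at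
least `n`. The ring of series is local with radical `𝔫`, so `D n` is `dim Jac(f)/𝔍ⁿ` (`jacDim_eq`).
The theorem thus reduces to bounding `D n` below, for every `f` of order at least `k = q + 3`, by
the number `N n` of words of length less than `n` that avoid `d` suitable leading words of length `k
- 1`.

Two inequalities meet. Put `p = n - (q + 1)`. The cyclic derivatives satisfy one syzygy, so the
matrix `(∂ⱼ(δᵢ f))` kills the vectors `(xᵢ g)ᵢ`. If these vectors determine `g`, counting dimensions
gives `1 + d D(n) + D(p-1) ≤ D(n+1) + d D(p)` (`truncDim_succ_ge`). On the combinatorial side,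
overlaps of leading words give `N(n+1) + d N(p) ≤ 1 + d N(n) + N(p-1)` (`card_normalLT_succ_le`). If
the normal words span, then `D ≤ N`, and induction forces `D = N` (`NormalSpans.truncDim_eq`). The
required injectivity comes along in the induction, since prepending the letter `0` keeps a word
normal.

Spanning is verified for one explicit model potential by rewriting words
(`normalSpans_modelPotential`). It is an open condition, so it holds for `f + s g` with `g` the
model and `s` generic. Since `D` can only drop under a generic perturbation of `f`, it follows that
`N n ≤ D n` for `f` itself (`card_normalLT_le_truncDim`). The recursion for `N` is then an equality
and yields the rational series, and an explicit three-parameter family of normal words gives cubic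
growth. -/

/-! ### Monomials and strike-off derivatives. -/

/-- The noncommutative monomial attached to a word. -/
def monomial (u : List (Fin d)) : NCPowerSeries d := mk fun w => if w = u then 1 else 0

theorem coeff_monomial (u w : List (Fin d)) :
    coeff w (monomial u) = if w = u then 1 else 0 := rfl

/-- The coefficient at a word, as a linear map. -/
def coeffₗ (w : List (Fin d)) : NCPowerSeries d →ₗ[ℂ] ℂ where
  toFun := coeff w
  map_add' _ _ := rfl
  map_smul' _ _ := rfl

@[simp] theorem coeffₗ_apply (w : List (Fin d)) (f : NCPowerSeries d) : coeffₗ w f = coeff w f := rfl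

theorem coeff_sum {ι : Type*} (s : Finset ι) (g : ι → NCPowerSeries d) (w : List (Fin d)) :
    coeff w (∑ i ∈ s, g i) = ∑ i ∈ s, coeff w (g i) := map_sum (coeffₗ w) g s

theorem coeff_sub (w : List (Fin d)) (f g : NCPowerSeries d) :
    coeff w (f - g) = coeff w f - coeff w g := rfl

theorem coeff_nil_mul (f g : NCPowerSeries d) : coeff [] (f * g) = coeff [] f * coeff [] g := by
  simp [coeff_mul]

theorem coeff_cons_mul (l : Fin d) (w : List (Fin d)) (f g : NCPowerSeries d) :
    coeff (l :: w) (f * g) = coeff w (strikeOff l f * g) + coeff [] f * coeff (l :: w) g := by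
  simp only [coeff_mul, List.length_cons]
  rw [Finset.sum_range_succ']
  simp [strikeOff]

theorem strikeOff_mul (j : Fin d) (f g : NCPowerSeries d) :
    strikeOff j (f * g) = strikeOff j f * g + coeff [] f • strikeOff j g := by
  ext w
  exact coeff_cons_mul j w f g

theorem strikeOff_mul_of_coeff_nil (j : Fin d) {f : NCPowerSeries d} (hf : coeff [] f = 0)
    (g : NCPowerSeries d) : strikeOff j (f * g) = strikeOff j f * g := by
  rw [strikeOff_mul, hf, zero_smul, add_zero]

theorem monomial_nil : monomial ([] : List (Fin d)) = 1 := rfl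

theorem strikeOff_monomial_cons (j l : Fin d) (u : List (Fin d)) :
    strikeOff j (monomial (l :: u)) = if j = l then monomial u else 0 := by
  ext w
  by_cases h : j = l <;> simp [strikeOff, coeff_monomial, h]

theorem strikeOff_monomial_singleton_mul (j l : Fin d) (g : NCPowerSeries d) :
    strikeOff j (monomial [l] * g) = if j = l then g else 0 := by
  rw [strikeOff_mul_of_coeff_nil j (by simp [coeff_monomial]), strikeOff_monomial_cons]
  split_ifs <;> simp [monomial_nil]

theorem monomial_cons (l : Fin d) (u : List (Fin d)) :
    monomial (l :: u) = monomial [l] * monomial u := by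
  ext w
  cases w with
  | nil => simp [coeff_nil_mul, coeff_monomial]
  | cons j w =>
    change coeff w (strikeOff j (monomial (l :: u))) =
      coeff w (strikeOff j (monomial [l] * monomial u))
    rw [strikeOff_monomial_singleton_mul, strikeOff_monomial_cons]

theorem monomial_append (u v : List (Fin d)) :
    monomial (u ++ v) = monomial u * monomial v := by
  induction u with
  | nil => rw [monomial_nil, one_mul, List.nil_append]
  | cons l u ih => rw [List.cons_append, monomial_cons, ih, monomial_cons l u, mul_assoc]

theorem coeff_mul_monomial_singleton (w : List (Fin d)) (l j : Fin d) (g : NCPowerSeries d) :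
    coeff (w ++ [l]) (g * monomial [j]) = if l = j then coeff w g else 0 := by
  rw [coeff_mul, Finset.sum_eq_single w.length]
  · simp [coeff_monomial]
  · intro i hi hne
    have hi' : i ≤ w.length + 1 := by simp at hi; omega
    rw [coeff_monomial, if_neg, mul_zero]
    intro h
    have := congrArg List.length h
    simp at this
    omega
  · simp

/-! ### The order filtration and truncation. -/

/-- The series of order at least `n`. -/
def orderGE (d n : ℕ) : Submodule ℂ (NCPowerSeries d) where
  carrier := {f | ∀ w : List (Fin d), w.length < n → coeff w f = 0}
  add_mem' := fun hf hg w hw => by rw [coeff_add, hf w hw, hg w hw, add_zero]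
  zero_mem' := fun _ _ => rfl
  smul_mem' := fun a f hf w hw => by rw [coeff_smul, hf w hw, mul_zero]

theorem mem_orderGE {n : ℕ} {f : NCPowerSeries d} :
    f ∈ orderGE d n ↔ ∀ w : List (Fin d), w.length < n → coeff w f = 0 := Iff.rfl

theorem orderGE_anti {m n : ℕ} (h : m ≤ n) : orderGE d n ≤ orderGE d m :=
  fun _ hf w hw => hf w (hw.trans_le h)

theorem mem_orderGE_zero (f : NCPowerSeries d) : f ∈ orderGE d 0 :=
  fun _ hw => absurd hw (Nat.not_lt_zero _)

theorem mul_mem_orderGE {a b n : ℕ} (hn : n ≤ a + b) {f g : NCPowerSeries d}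
    (hf : f ∈ orderGE d a) (hg : g ∈ orderGE d b) : f * g ∈ orderGE d n := by
  intro w hw
  rw [coeff_mul]
  refine Finset.sum_eq_zero fun i hi => ?_
  by_cases h : i < a
  · rw [hf _ (by simp; omega), zero_mul]
  · rw [hg _ (by simp at hi ⊢; omega), mul_zero]

theorem monomial_mem_orderGE {n : ℕ} {u : List (Fin d)} (h : n ≤ u.length) :
    monomial u ∈ orderGE d n := by
  intro w hw
  rw [coeff_monomial, if_neg]
  rintro rfl
  omega

theorem strikeOff_mem_orderGE {n : ℕ} {f : NCPowerSeries d} (hf : f ∈ orderGE d (n + 1)) (i : Fin d) :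
    strikeOff i f ∈ orderGE d n :=
  fun w hw => hf (i :: w) (by simpa using hw)

theorem sym_mem_orderGE {n : ℕ} {f : NCPowerSeries d} (hf : f ∈ orderGE d n) :
    sym f ∈ orderGE d n :=
  fun w hw => by
    rw [sym, coeff_mk]
    exact Finset.sum_eq_zero fun j _ => hf _ (by simpa using hw)

theorem cyclicDeriv_mem_orderGE {n : ℕ} {f : NCPowerSeries d} (hf : f ∈ orderGE d (n + 1))
    (i : Fin d) : cyclicDeriv i f ∈ orderGE d n :=
  strikeOff_mem_orderGE (sym_mem_orderGE hf) i

/-- The words of length less than `n`. -/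
def wordsLT (d n : ℕ) : Finset (List (Fin d)) := (List.finite_length_lt (Fin d) n).toFinset

@[simp] theorem mem_wordsLT {n : ℕ} {w : List (Fin d)} : w ∈ wordsLT d n ↔ w.length < n := by
  simp [wordsLT]

/-- The truncation of a series to the words of length less than `n`. -/
def trunc (n : ℕ) (f : NCPowerSeries d) : NCPowerSeries d :=
  ∑ w ∈ wordsLT d n, coeff w f • monomial w

theorem coeff_trunc (n : ℕ) (f : NCPowerSeries d) (w : List (Fin d)) :
    coeff w (trunc n f) = if w.length < n then coeff w f else 0 := by
  simp [trunc, coeff_sum, coeff_monomial]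

theorem sub_trunc_mem (n : ℕ) (f : NCPowerSeries d) : f - trunc n f ∈ orderGE d n := by
  intro w hw
  rw [coeff_sub, coeff_trunc, if_pos hw, sub_self]

instance finite_quotient_orderGE (n : ℕ) :
    Module.Finite ℂ (NCPowerSeries d ⧸ orderGE d n) := by
  have : (LinearMap.pi fun w : wordsLT d n => coeffₗ w.1).ker = orderGE d n := by
    ext f
    simp [mem_orderGE, funext_iff]
  rw [← this]
  exact Module.Finite.equiv (LinearMap.quotKerEquivRange _).symm

/-! ### Cyclic derivatives and their syzygy. -/

/-- Both words have the same rotations. This cyclic invariance is the source of the syzygy. -/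
theorem coeff_sym_cons (f : NCPowerSeries d) (l : Fin d) (w : List (Fin d)) :
    coeff (l :: w) (sym f) = coeff (w ++ [l]) (sym f) := by
  simp only [sym, coeff_mk, List.length_cons, List.length_append, List.length_nil, zero_add]
  rw [Finset.sum_range_succ', Finset.sum_range_succ]
  rw [List.rotate_append_length_eq, List.rotate_zero]
  simp only [List.rotate_cons_succ, List.singleton_append]

/-- The cyclic derivatives of `f` satisfy `∑ᵢ ∂ⱼ(δᵢ f) xᵢ = δⱼ f`. -/
theorem sum_strikeOff_cyclicDeriv_mul {f : NCPowerSeries d} (hf : f ∈ orderGE d 2) (j : Fin d) :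
    ∑ i, strikeOff j (cyclicDeriv i f) * monomial [i] = cyclicDeriv j f := by
  ext w
  rw [coeff_sum]
  rcases List.eq_nil_or_concat w with rfl | ⟨w, l, rfl⟩
  · rw [(cyclicDeriv_mem_orderGE hf j) [] (by simp)]
    simp [coeff_nil_mul, coeff_monomial]
  · rw [List.concat_eq_append]
    simp only [coeff_mul_monomial_singleton, Finset.sum_ite_eq, Finset.mem_univ, if_true]
    -- The two sides are the coefficients of `sym f` at `l :: j :: w` and at `j :: w ++ [l]`.
    exact coeff_sym_cons f l (j :: w)

theorem cyclicDeriv_add (i : Fin d) (f g : NCPowerSeries d) :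
    cyclicDeriv i (f + g) = cyclicDeriv i f + cyclicDeriv i g := by
  ext w
  simp [cyclicDeriv, strikeOff, sym, Finset.sum_add_distrib]

theorem cyclicDeriv_smul (i : Fin d) (a : ℂ) (f : NCPowerSeries d) :
    cyclicDeriv i (a • f) = a • cyclicDeriv i f := by
  ext w
  simp [cyclicDeriv, strikeOff, sym, Finset.mul_sum]

/-! ### The relations at finite precision. -/

/-- The multiple of a relation by a word on either side. -/
def relation (f : NCPowerSeries d) (p : List (Fin d) × Fin d × List (Fin d)) : NCPowerSeries d :=
  monomial p.1 * cyclicDeriv p.2.1 f * monomial p.2.2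

/-- The span of all multiples of the cyclic derivatives of `f` by words. -/
def relationSpan (f : NCPowerSeries d) : Submodule ℂ (NCPowerSeries d) :=
  Submodule.span ℂ (Set.range (relation f))

/-- The ideal of relations, modulo series of order at least `n`. -/
def relationsMod (f : NCPowerSeries d) (n : ℕ) : Submodule ℂ (NCPowerSeries d) :=
  relationSpan f ⊔ orderGE d n

theorem relation_mem (f : NCPowerSeries d) (n : ℕ) (p) : relation f p ∈ relationsMod f n :=
  Submodule.mem_sup_left (Submodule.subset_span ⟨p, rfl⟩)

theorem orderGE_le (f : NCPowerSeries d) (n : ℕ) : orderGE d n ≤ relationsMod f n := le_sup_right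

theorem relationsMod_anti (f : NCPowerSeries d) {m n : ℕ} (h : m ≤ n) :
    relationsMod f n ≤ relationsMod f m := sup_le_sup_left (orderGE_anti h) _

theorem relationsMod_zero (f : NCPowerSeries d) : relationsMod f 0 = ⊤ :=
  top_le_iff.mp fun g _ => orderGE_le f 0 (mem_orderGE_zero g)

instance finite_quotient_relationsMod (f : NCPowerSeries d) (n : ℕ) :
    Module.Finite ℂ (NCPowerSeries d ⧸ relationsMod f n) :=
  Module.Finite.of_surjective (Submodule.factor (orderGE_le f n))
    (Submodule.factor_surjective (orderGE_le f n))

theorem monomial_mul_mem_relationSpan {f g : NCPowerSeries d} (u : List (Fin d))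
    (hg : g ∈ relationSpan f) : monomial u * g ∈ relationSpan f := by
  have : relationSpan f ≤ (relationSpan f).comap (LinearMap.mulLeft ℂ (monomial u)) := by
    refine Submodule.span_le.mpr ?_
    rintro _ ⟨p, rfl⟩
    refine Submodule.subset_span ⟨(u ++ p.1, p.2), ?_⟩
    simp [relation, monomial_append, mul_assoc]
  exact this hg

theorem mul_monomial_mem_relationSpan {f g : NCPowerSeries d} (u : List (Fin d))
    (hg : g ∈ relationSpan f) : g * monomial u ∈ relationSpan f := by
  have : relationSpan f ≤ (relationSpan f).comap (LinearMap.mulRight ℂ (monomial u)) := by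
    refine Submodule.span_le.mpr ?_
    rintro _ ⟨p, rfl⟩
    refine Submodule.subset_span ⟨(p.1, p.2.1, p.2.2 ++ u), ?_⟩
    simp [relation, monomial_append, mul_assoc]
  exact this hg

/-- Multiplying by a series of order `a` on the left raises the precision by `a`. -/
theorem mul_mem_relationsMod_of_le {f : NCPowerSeries d} {a m n : ℕ} (h : n ≤ a + m)
    {g x : NCPowerSeries d} (hg : g ∈ orderGE d a) (hx : x ∈ relationsMod f m) :
    g * x ∈ relationsMod f n := by
  obtain ⟨y, hy, z, hz, rfl⟩ := Submodule.mem_sup.mp hx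
  rw [mul_add]
  refine add_mem ?_ (orderGE_le f n (mul_mem_orderGE h hg hz))
  -- The span is stable under words only, hence under polynomials, so the tail of `g` has to be
  -- absorbed in the series of order at least `n`.
  rw [← sub_add_cancel g (trunc n g), add_mul]
  refine add_mem (orderGE_le f n (mul_mem_orderGE (b := 0) le_rfl (sub_trunc_mem n g)
    (mem_orderGE_zero y))) (Submodule.mem_sup_left ?_)
  rw [trunc, Finset.sum_mul]
  refine sum_mem fun w _ => ?_
  rw [smul_mul_assoc]
  exact Submodule.smul_mem _ _ (monomial_mul_mem_relationSpan w hy)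

theorem mul_mem_relationsMod_left {f : NCPowerSeries d} {n : ℕ} (g : NCPowerSeries d)
    {x : NCPowerSeries d} (hx : x ∈ relationsMod f n) : g * x ∈ relationsMod f n :=
  mul_mem_relationsMod_of_le (Nat.zero_add n).ge (mem_orderGE_zero g) hx

theorem mul_mem_relationsMod_right {f : NCPowerSeries d} {n : ℕ} (g : NCPowerSeries d)
    {x : NCPowerSeries d} (hx : x ∈ relationsMod f n) : x * g ∈ relationsMod f n := by
  obtain ⟨y, hy, z, hz, rfl⟩ := Submodule.mem_sup.mp hx
  rw [add_mul]
  refine add_mem ?_ (orderGE_le f n (mul_mem_orderGE (b := 0) le_rfl hz (mem_orderGE_zero g)))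
  rw [← sub_add_cancel g (trunc n g), mul_add]
  refine add_mem (orderGE_le f n (mul_mem_orderGE (a := 0) (Nat.zero_add n).ge (mem_orderGE_zero y)
    (sub_trunc_mem n g))) (Submodule.mem_sup_left ?_)
  rw [trunc, Finset.mul_sum]
  refine sum_mem fun w _ => ?_
  rw [mul_smul_comm]
  exact Submodule.smul_mem _ _ (mul_monomial_mem_relationSpan w hy)

theorem cyclicDeriv_mem_relationsMod (f : NCPowerSeries d) (i : Fin d) (n : ℕ) :
    cyclicDeriv i f ∈ relationsMod f n := by
  have := relation_mem f n ([], i, [])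
  simpa [relation, monomial_nil] using this

/-! ### Powers of the Jacobson radical. -/

theorem mem_maxIdeal {g : NCPowerSeries d} : g ∈ maxIdeal d ↔ coeff [] g = 0 := Iff.rfl

theorem sum_mul_monomial {g : NCPowerSeries d} (hg : coeff [] g = 0) :
    ∑ j, mk (fun w => coeff (w ++ [j]) g) * monomial [j] = g := by
  ext w
  rw [coeff_sum]
  rcases List.eq_nil_or_concat w with rfl | ⟨w, l, rfl⟩
  · simp [coeff_nil_mul, coeff_monomial, hg]
  · rw [List.concat_eq_append]
    simp [coeff_mul_monomial_singleton]

/-- With finitely many letters, a series without constant term is a finite sum `∑ gⱼ xⱼ`, so the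
algebraic power of `𝔫` is already closed. -/
theorem mem_maxIdeal_pow {n : ℕ} {g : NCPowerSeries d} :
    g ∈ maxIdeal d ^ n ↔ g ∈ orderGE d n := by
  induction n generalizing g with
  | zero =>
    rw [Submodule.pow_zero, Ideal.one_eq_top]
    exact ⟨fun _ => mem_orderGE_zero g, fun _ => trivial⟩
  | succ n ih =>
    rw [Submodule.pow_succ]
    constructor
    · intro h
      refine Submodule.mul_induction_on h (fun a ha b hb => ?_) fun a b ha hb => add_mem ha hb
      refine mul_mem_orderGE le_rfl (ih.mp ha) fun w hw => ?_
      obtain rfl : w = [] := List.length_eq_zero_iff.mp (by omega)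
      exact hb
    · intro h
      rw [← sum_mul_monomial (h [] (by simp))]
      refine sum_mem fun j _ => Ideal.mul_mem_mul (ih.mpr fun w hw => ?_) ?_
      · exact h _ (by simpa using hw)
      · simp [mem_maxIdeal, coeff_monomial]

theorem pow_mem_orderGE {g : NCPowerSeries d} (hg : coeff [] g = 0) (n : ℕ) :
    g ^ n ∈ orderGE d n :=
  mem_maxIdeal_pow.mp (Ideal.pow_mem_pow hg n)

/-- A series with constant term `1` has a left inverse. -/
theorem exists_mul_one_sub_eq_one {g : NCPowerSeries d} (hg : coeff [] g = 0) :
    ∃ h : NCPowerSeries d, h * (1 - g) = 1 := by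
  have key : ∀ (w : List (Fin d)) (N : ℕ), w.length < N →
      coeff w (∑ i ∈ Finset.range (w.length + 1), g ^ i) = coeff w (∑ i ∈ Finset.range N, g ^ i) := by
    intro w N hN
    rw [coeff_sum, coeff_sum]
    refine Finset.sum_subset (by simpa using hN) fun i _ hi => ?_
    exact pow_mem_orderGE hg i w (by simp at hi; omega)
  -- The geometric series in `g`: at a word `w` only the powers up to `w.length` contribute.
  refine ⟨mk fun w => coeff w (∑ i ∈ Finset.range (w.length + 1), g ^ i), ?_⟩
  ext w
  have h1 : coeff w (mk (fun w => coeff w (∑ i ∈ Finset.range (w.length + 1), g ^ i)) * (1 - g)) =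
      coeff w ((∑ i ∈ Finset.range (w.length + 1), g ^ i) * (1 - g)) := by
    rw [coeff_mul, coeff_mul]
    refine Finset.sum_congr rfl fun i _ => ?_
    rw [coeff_mk, key _ (w.length + 1) (by simp)]
  rw [h1, geom_sum_mul_neg, coeff_sub, pow_mem_orderGE hg _ w (Nat.lt_succ_self _), sub_zero]

instance isMaximal_maxIdeal : (maxIdeal d).IsMaximal := by
  rw [Ideal.isMaximal_iff]
  refine ⟨fun h => ?_, fun J x hJ hx hxJ => ?_⟩
  · rw [mem_maxIdeal, coeff_one, if_pos rfl] at h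
    exact one_ne_zero h
  · have hx' : coeff [] x ≠ 0 := hx
    have h1 : (coeff [] x)⁻¹ • (1 : NCPowerSeries d) * x - 1 ∈ maxIdeal d := by
      rw [mem_maxIdeal, coeff_sub, coeff_nil_mul, coeff_smul, coeff_one, if_pos rfl, mul_one,
        inv_mul_cancel₀ hx', sub_self]
    have h2 := J.sub_mem (J.mul_mem_left ((coeff [] x)⁻¹ • (1 : NCPowerSeries d)) hxJ) (hJ h1)
    rwa [sub_sub_cancel] at h2

theorem jacobson_eq_maxIdeal : Ring.jacobson (NCPowerSeries d) = maxIdeal d := by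
  refine le_antisymm (Ring.jacobson_le_of_isMaximal _) ?_
  rw [Ring.jacobson_eq_sInf_isMaximal]
  refine le_sInf fun M hM x hx => ?_
  have hM : M.IsMaximal := hM
  by_contra hxM
  obtain ⟨y, m, hm, hmy⟩ := hM.exists_inv hxM
  obtain ⟨h, hh⟩ := exists_mul_one_sub_eq_one (g := y * x)
    (by rw [coeff_nil_mul, mem_maxIdeal.mp hx, mul_zero])
  rw [← hmy, add_sub_cancel_left, hmy] at hh
  exact hM.ne_top ((Ideal.eq_top_iff_one _).mpr (hh ▸ M.mul_mem_left h hm))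

/-- `relationsMod` as a two-sided ideal. -/
def relationsModIdeal (f : NCPowerSeries d) (n : ℕ) : TwoSidedIdeal (NCPowerSeries d) :=
  TwoSidedIdeal.mk' (relationsMod f n) (zero_mem _) add_mem neg_mem
    (mul_mem_relationsMod_left _) (mul_mem_relationsMod_right _)

/-- Taking the closure changes nothing modulo `𝔫ⁿ`, and there the ideal is spanned by the multiples
of the generators by words. -/
theorem mem_jacobiIdeal_sup {f g : NCPowerSeries d} {n : ℕ} :
    g ∈ jacobiIdeal f ⊔ maxIdeal d ^ n ↔ g ∈ relationsMod f n := by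
  have hspan : ∀ x ∈ (TwoSidedIdeal.span (Set.range fun i : Fin d => cyclicDeriv i f)).asIdeal,
      x ∈ relationsMod f n := by
    intro x hx
    rw [TwoSidedIdeal.mem_asIdeal, TwoSidedIdeal.mem_span_iff] at hx
    have := hx (relationsModIdeal f n) (by
      rintro _ ⟨i, rfl⟩
      simpa [relationsModIdeal] using cyclicDeriv_mem_relationsMod f i n)
    simpa [relationsModIdeal] using this
  constructor
  · intro h
    obtain ⟨x, hx, y, hy, rfl⟩ := Submodule.mem_sup.mp h
    refine add_mem ?_ (orderGE_le f n (mem_maxIdeal_pow.mp hy))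
    have hx' := (iInf_le _ n : jacobiIdeal f ≤ _) hx
    obtain ⟨a, ha, b, hb, rfl⟩ := Submodule.mem_sup.mp hx'
    exact add_mem (hspan a ha) (orderGE_le f n (mem_maxIdeal_pow.mp hb))
  · intro h
    obtain ⟨x, hx, y, hy, rfl⟩ := Submodule.mem_sup.mp h
    refine Submodule.add_mem_sup ?_ (mem_maxIdeal_pow.mpr hy)
    refine (le_iInf fun _ => le_sup_left : _ ≤ jacobiIdeal f) ?_
    refine Submodule.span_induction (p := fun z _ => z ∈ TwoSidedIdeal.asIdeal
      (TwoSidedIdeal.span (Set.range fun i : Fin d => cyclicDeriv i f))) ?_ (zero_mem _)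
      (fun _ _ _ _ ha hb => add_mem ha hb) (fun a z _ hz => ?_) hx
    · rintro _ ⟨p, rfl⟩
      rw [TwoSidedIdeal.mem_asIdeal]
      exact TwoSidedIdeal.mul_mem_right _ _ _ (TwoSidedIdeal.mul_mem_left _ _ _
        (TwoSidedIdeal.subset_span ⟨p.2.1, rfl⟩))
    · rw [← one_mul z, ← smul_mul_assoc]
      exact Ideal.mul_mem_left _ _ hz

theorem relationsMod_one {f : NCPowerSeries d} (hf : f ∈ orderGE d 2) :
    relationsMod f 1 ≤ orderGE d 1 := by
  refine sup_le (Submodule.span_le.mpr ?_) le_rfl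
  rintro _ ⟨p, rfl⟩
  exact mul_mem_orderGE (b := 0) le_rfl (mul_mem_orderGE (a := 0) le_rfl (mem_orderGE_zero _)
    (cyclicDeriv_mem_orderGE hf _)) (mem_orderGE_zero _)

theorem jacobiIdeal_le {f : NCPowerSeries d} (hf : f ∈ orderGE d 2) :
    jacobiIdeal f ≤ maxIdeal d := fun g hg =>
  relationsMod_one hf (mem_jacobiIdeal_sup.mp ((le_sup_left : _ ≤ _ ⊔ maxIdeal d ^ 1) hg))
    [] (by simp)

/-- The Jacobi ideal lies in `𝔫`, the radical of the series ring, so the radical of the quotient is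
the image of `𝔫`, and its powers are the images of the powers of `𝔫`. -/
theorem mk_mem_jacobson_pow {f : NCPowerSeries d} (hf : f ∈ orderGE d 2) (n : ℕ)
    (g : NCPowerSeries d) :
    Ideal.Quotient.mk (jacobiIdeal f) g ∈ (Ring.jacobson (Jac f) ^ n : Ideal (Jac f)) ↔
      g ∈ relationsMod f n := by
  have surj : Function.Surjective (Ideal.Quotient.mk (jacobiIdeal f)) :=
    Ideal.Quotient.mk_surjective
  have hJ : ∀ y, y ∈ Ring.jacobson (Jac f) ↔
      ∃ x ∈ maxIdeal d, Ideal.Quotient.mk (jacobiIdeal f) x = y := by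
    intro y
    rw [Ring.jacobson_quotient_of_le (jacobson_eq_maxIdeal (d := d) ▸ jacobiIdeal_le hf),
      jacobson_eq_maxIdeal]
    exact Submodule.mem_map
  have hpow : ∀ y, y ∈ (Ring.jacobson (Jac f) ^ n : Ideal (Jac f)) ↔
      ∃ x ∈ maxIdeal d ^ n, Ideal.Quotient.mk (jacobiIdeal f) x = y := by
    induction n with
    | zero =>
      intro y
      obtain ⟨x, rfl⟩ := surj y
      simp only [Submodule.pow_zero, Ideal.one_eq_top, Submodule.mem_top, true_and, true_iff]
      exact ⟨x, rfl⟩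
    | succ n ih =>
      intro y
      rw [Submodule.pow_succ, Submodule.pow_succ]
      constructor
      · intro h
        refine Submodule.mul_induction_on h ?_ ?_
        · intro a ha b hb
          obtain ⟨a', ha', rfl⟩ := (ih a).mp ha
          obtain ⟨b', hb', rfl⟩ := (hJ b).mp hb
          exact ⟨a' * b', Ideal.mul_mem_mul ha' hb', map_mul _ _ _⟩
        · rintro _ _ ⟨a, ha, rfl⟩ ⟨b, hb, rfl⟩
          exact ⟨a + b, add_mem ha hb, map_add _ _ _⟩
      · rintro ⟨x, hx, rfl⟩
        refine Submodule.mul_induction_on hx ?_ ?_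
        · intro a ha b hb
          rw [map_mul]
          exact Ideal.mul_mem_mul ((ih _).mpr ⟨a, ha, rfl⟩) ((hJ _).mpr ⟨b, hb, rfl⟩)
        · intro a b ha hb
          rw [map_add]
          exact add_mem ha hb
  rw [hpow, ← mem_jacobiIdeal_sup]
  constructor
  · rintro ⟨x, hx, hxg⟩
    rw [← sub_add_cancel g x]
    refine Submodule.add_mem_sup ?_ hx
    rw [Ideal.Quotient.mk_eq_mk_iff_sub_mem] at hxg
    rw [← neg_sub]
    exact neg_mem hxg
  · intro h
    obtain ⟨a, ha, b, hb, rfl⟩ := Submodule.mem_sup.mp h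
    exact ⟨b, hb, by rw [map_add, Ideal.Quotient.eq_zero_iff_mem.mpr ha, zero_add]⟩

theorem jacDim_eq {f : NCPowerSeries d} (hf : f ∈ orderGE d 2) (n : ℕ) :
    jacDim f n = Module.finrank ℂ (NCPowerSeries d ⧸ relationsMod f n) := by
  let J : Ideal (Jac f) := Ring.jacobson (Jac f) ^ n
  let φ : NCPowerSeries d →ₗ[ℂ] Jac f ⧸ J :=
    ((J.mkQ).restrictScalars ℂ) ∘ₗ (((jacobiIdeal f).mkQ).restrictScalars ℂ)
  have hφ : Function.Surjective φ :=
    (Submodule.mkQ_surjective J).comp (Submodule.mkQ_surjective (jacobiIdeal f))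
  have hker : φ.ker = relationsMod f n := by
    ext g
    rw [LinearMap.mem_ker, ← mk_mem_jacobson_pow hf]
    exact Submodule.Quotient.mk_eq_zero J
  rw [← hker]
  exact (LinearMap.quotKerEquivOfSurjective φ hφ).finrank_eq.symm

/-! ### The dimension estimate from the syzygy. -/

/-- The dimension of the free algebra modulo the relations and series of order at least `n`. -/
def truncDim (f : NCPowerSeries d) (n : ℕ) : ℕ :=
  Module.finrank ℂ (NCPowerSeries d ⧸ relationsMod f n)

theorem truncDim_zero (f : NCPowerSeries d) : truncDim f 0 = 0 := by
  have : Subsingleton (NCPowerSeries d ⧸ relationsMod f 0) :=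
    Submodule.Quotient.subsingleton_iff.mpr (relationsMod_zero f)
  exact Module.finrank_zero_of_subsingleton

/-- The strike-off derivative as a linear map. -/
def strikeOffₗ (j : Fin d) : NCPowerSeries d →ₗ[ℂ] NCPowerSeries d where
  toFun := strikeOff j
  map_add' _ _ := rfl
  map_smul' _ _ := rfl

/-- Left multiplication by `g`, as a map from the quotient at precision `m` to that at `n`. -/
def mulLeftQ (f : NCPowerSeries d) {a m n : ℕ} (h : n ≤ a + m) (g : orderGE d a) :
    (NCPowerSeries d ⧸ relationsMod f m) →ₗ[ℂ] (NCPowerSeries d ⧸ relationsMod f n) :=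
  Submodule.mapQ _ _ (LinearMap.mulLeft ℂ g.1) fun _ hx => mul_mem_relationsMod_of_le h g.2 hx

/-- The matrix `(∂ⱼ(δᵢ f))` acting on column vectors. -/
def hessian {f : NCPowerSeries d} {k p n : ℕ} (hf : f ∈ orderGE d (k + 2)) (h : n ≤ k + p) :
    (Fin d → NCPowerSeries d ⧸ relationsMod f p) →ₗ[ℂ]
      (Fin d → NCPowerSeries d ⧸ relationsMod f n) :=
  LinearMap.pi fun j => ∑ i, mulLeftQ f h
    ⟨strikeOff j (cyclicDeriv i f), strikeOff_mem_orderGE (cyclicDeriv_mem_orderGE hf i) j⟩ ∘ₗ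
      LinearMap.proj i

theorem hessian_mk {f : NCPowerSeries d} {k p n : ℕ} (hf : f ∈ orderGE d (k + 2)) (h : n ≤ k + p)
    (v : Fin d → NCPowerSeries d) (j : Fin d) :
    hessian hf h (fun i => (relationsMod f p).mkQ (v i)) j =
      (relationsMod f n).mkQ (∑ i, strikeOff j (cyclicDeriv i f) * v i) := by
  simp only [hessian, mulLeftQ, LinearMap.pi_apply, LinearMap.sum_apply, map_sum]
  rfl

/-- The constant term and the strike-off derivatives modulo relations. -/
def splitQ (f : NCPowerSeries d) (n : ℕ) :
    NCPowerSeries d →ₗ[ℂ] ℂ × (Fin d → NCPowerSeries d ⧸ relationsMod f n) :=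
  (coeffₗ []).prod (LinearMap.pi fun j => (relationsMod f n).mkQ ∘ₗ strikeOffₗ j)

theorem splitQ_surjective (f : NCPowerSeries d) (n : ℕ) : Function.Surjective (splitQ f n) := by
  rintro ⟨a, v⟩
  choose g hg using fun j => (relationsMod f n).mkQ_surjective (v j)
  refine ⟨mk fun w => match w with
    | [] => a
    | l :: w => coeff w (g l), Prod.ext rfl (funext fun j => ?_)⟩
  exact hg j

/-- Striking off a letter sends `u (δᵢ f) v` with `u` nonempty to zero or to another relation. Only
the products `(δᵢ f) v` survive, and they give the `i`-th column of the Hessian times `v`. -/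
theorem map_splitQ_le {f : NCPowerSeries d} {k p n : ℕ} (hf : f ∈ orderGE d (k + 2))
    (h : n ≤ k + p) :
    (relationsMod f (n + 1)).map (splitQ f n) ≤
      (hessian hf h).range.map (LinearMap.inr ℂ ℂ _) := by
  rw [Submodule.map_le_iff_le_comap]
  refine sup_le (Submodule.span_le.mpr ?_) fun g hg => ?_
  · rintro _ ⟨⟨u, i, v⟩, rfl⟩
    rw [SetLike.mem_coe, Submodule.mem_comap]
    have hi : coeff [] (cyclicDeriv i f) = 0 := cyclicDeriv_mem_orderGE hf i [] (by simp)
    have h0 : coeff [] (relation f (u, i, v)) = 0 := by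
      simp [relation, coeff_nil_mul, hi]
    cases u with
    | nil =>
      refine ⟨_, ⟨fun l => (relationsMod f p).mkQ (if l = i then monomial v else 0), rfl⟩, ?_⟩
      refine Prod.ext h0.symm (funext fun j => ?_)
      refine (hessian_mk hf h (fun l => if l = i then monomial v else 0) j).trans ?_
      change _ = (relationsMod f n).mkQ (strikeOff j (relation f ([], i, v)))
      congr 1
      simp [relation, monomial_nil, strikeOff_mul_of_coeff_nil j hi]
    | cons l u =>
      suffices splitQ f n (relation f (l :: u, i, v)) = 0 by rw [this]; exact zero_mem _
      refine Prod.ext h0 (funext fun j => ?_)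
      change (relationsMod f n).mkQ (strikeOff j (relation f (l :: u, i, v))) = 0
      have : relation f (l :: u, i, v) = monomial [l] * relation f (u, i, v) := by
        simp only [relation]
        rw [monomial_cons, mul_assoc, mul_assoc, mul_assoc]
      rw [this, strikeOff_monomial_singleton_mul]
      split_ifs
      · exact (Submodule.Quotient.mk_eq_zero _).mpr (relation_mem f n _)
      · exact map_zero _
  · suffices splitQ f n g = 0 by rw [Submodule.mem_comap, this]; exact zero_mem _
    refine Prod.ext (hg [] (by simp)) (funext fun j => ?_)
    exact (Submodule.Quotient.mk_eq_zero _).mpr (orderGE_le f n (strikeOff_mem_orderGE hg j))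

/-- A constant term and `d` strike-offs can be prescribed freely, so dividing these data by the
image of the Hessian leaves a quotient of the algebra at precision `n + 1`. -/
theorem le_truncDim_succ_add {f : NCPowerSeries d} {k p n : ℕ} (hf : f ∈ orderGE d (k + 2))
    (h : n ≤ k + p) :
    1 + d * truncDim f n ≤
      truncDim f (n + 1) + Module.finrank ℂ (hessian hf h).range := by
  set W := (hessian hf h).range.map (LinearMap.inr ℂ ℂ _) with hW
  have h1 : Module.finrank ℂ ((ℂ × (Fin d → NCPowerSeries d ⧸ relationsMod f n)) ⧸ W) ≤
      truncDim f (n + 1) := by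
    refine LinearMap.finrank_le_finrank_of_surjective
      (f := Submodule.mapQ (relationsMod f (n + 1)) W (splitQ f n)
        (Submodule.map_le_iff_le_comap.mp (map_splitQ_le hf h))) ?_
    intro y
    obtain ⟨y, rfl⟩ := Submodule.mkQ_surjective _ y
    obtain ⟨x, rfl⟩ := splitQ_surjective f n y
    exact ⟨Submodule.Quotient.mk x, rfl⟩
  have h2 := W.finrank_quotient_add_finrank
  have h3 : Module.finrank ℂ (ℂ × (Fin d → NCPowerSeries d ⧸ relationsMod f n)) =
      1 + d * truncDim f n := by
    rw [Module.finrank_prod, Module.finrank_pi_fintype]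
    simp [truncDim]
  have h4 : Module.finrank ℂ W ≤ Module.finrank ℂ (hessian hf h).range :=
    Submodule.finrank_map_le _ _
  omega

/-- Left multiplication by all letters, modulo relations. -/
def mulLettersQ (f : NCPowerSeries d) (p : ℕ) :
    NCPowerSeries d →ₗ[ℂ] (Fin d → NCPowerSeries d ⧸ relationsMod f p) :=
  LinearMap.pi fun i => (relationsMod f p).mkQ ∘ₗ LinearMap.mulLeft ℂ (monomial [i])

/-- By the syzygy, the Hessian sends `(xᵢ g)ᵢ` to `((δⱼ f) g)ⱼ`, which consists of relations. -/
theorem range_mulLettersQ_le {f : NCPowerSeries d} {k p n : ℕ} (hf : f ∈ orderGE d (k + 2))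
    (h : n ≤ k + p) : (mulLettersQ f p).range ≤ (hessian hf h).ker := by
  rintro _ ⟨g, rfl⟩
  rw [LinearMap.mem_ker]
  funext j
  refine (hessian_mk hf h (fun i => monomial [i] * g) j).trans ?_
  simp only [← mul_assoc, ← Finset.sum_mul]
  rw [sum_strikeOff_cyclicDeriv_mul (orderGE_anti (by omega) hf)]
  exact (Submodule.Quotient.mk_eq_zero _).mpr
    (mul_mem_relationsMod_right g (cyclicDeriv_mem_relationsMod f j n))

/-- The Golod–Shafarevich type estimate, improved by the syzygy between the cyclic derivatives. -/
theorem truncDim_succ_ge {f : NCPowerSeries d} {k p n : ℕ} (hf : f ∈ orderGE d (k + 2))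
    (h : n ≤ k + p)
    (hinj : ∀ g, (∀ i, monomial [i] * g ∈ relationsMod f p) → g ∈ relationsMod f (p - 1)) :
    1 + d * truncDim f n + truncDim f (p - 1) ≤ truncDim f (n + 1) + d * truncDim f p := by
  have h1 := le_truncDim_succ_add hf h
  have h2 := (hessian hf h).finrank_range_add_finrank_ker
  have h3 : Module.finrank ℂ (Fin d → NCPowerSeries d ⧸ relationsMod f p) = d * truncDim f p := by
    rw [Module.finrank_pi_fintype]
    simp [truncDim]
  have h4 : truncDim f (p - 1) ≤ Module.finrank ℂ (hessian hf h).ker := by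
    refine le_trans ?_ (Submodule.finrank_mono (range_mulLettersQ_le hf h))
    have hker : (mulLettersQ f p).ker ≤ relationsMod f (p - 1) := by
      intro g hg
      refine hinj g fun i => (Submodule.Quotient.mk_eq_zero _).mp ?_
      exact congrFun (LinearMap.mem_ker.mp hg) i
    have e := (mulLettersQ f p).quotKerEquivRange
    rw [← e.finrank_eq]
    have : Module.Finite ℂ (NCPowerSeries d ⧸ (mulLettersQ f p).ker) := Module.Finite.equiv e.symm
    exact LinearMap.finrank_le_finrank_of_surjective (Submodule.factor_surjective hker)
  omega

/-! ### Normal words. -/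

/-- A word is normal if it contains none of the words `m j`. -/
def IsNormal (m : Fin d → List (Fin d)) (w : List (Fin d)) : Prop := ∀ j, ¬ m j <:+: w

open Classical in
/-- The normal words of length less than `n`. -/
def normalLT (m : Fin d → List (Fin d)) (n : ℕ) : Finset (List (Fin d)) :=
  (wordsLT d n).filter (IsNormal m)

theorem mem_normalLT {m : Fin d → List (Fin d)} {n : ℕ} {w : List (Fin d)} :
    w ∈ normalLT m n ↔ w.length < n ∧ IsNormal m w := by
  simp [normalLT]

theorem normalLT_zero (m : Fin d → List (Fin d)) : normalLT m 0 = ∅ := by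
  ext w
  simp [mem_normalLT]

theorem isNormal_cons {m : Fin d → List (Fin d)} {l : Fin d} {w : List (Fin d)} :
    IsNormal m (l :: w) ↔ (∀ j, ¬ m j <+: l :: w) ∧ IsNormal m w := by
  simp only [IsNormal, List.infix_cons_iff, not_or, forall_and]

/-- The normal words of length less than `n` span the algebra modulo relations and series of order
at least `n`. -/
def NormalSpans (m : Fin d → List (Fin d)) (f : NCPowerSeries d) (n : ℕ) : Prop :=
  Submodule.span ℂ (Set.range fun w : normalLT m n => monomial w.1) ⊔ relationsMod f n = ⊤

theorem NormalSpans.anti {m : Fin d → List (Fin d)} {f : NCPowerSeries d} {n n' : ℕ} (h : n' ≤ n)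
    (hf : NormalSpans m f n) : NormalSpans m f n' := by
  refine top_le_iff.mp (hf.symm.le.trans (sup_le (Submodule.span_le.mpr ?_)
    ((relationsMod_anti f h).trans le_sup_right)))
  rintro _ ⟨⟨w, hw⟩, rfl⟩
  rw [mem_normalLT] at hw
  by_cases hl : w.length < n'
  · exact Submodule.mem_sup_left (Submodule.subset_span ⟨⟨w, mem_normalLT.mpr ⟨hl, hw.2⟩⟩, rfl⟩)
  · exact Submodule.mem_sup_right (orderGE_le f n' (monomial_mem_orderGE (not_lt.mp hl)))

theorem NormalSpans.top_le_span {m : Fin d → List (Fin d)} {f : NCPowerSeries d} {n : ℕ}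
    (hf : NormalSpans m f n) :
    ⊤ ≤ Submodule.span ℂ (Set.range fun w : normalLT m n => (relationsMod f n).mkQ (monomial w.1)) := by
  have := congrArg (Submodule.map (relationsMod f n).mkQ) hf
  rw [Submodule.map_sup, Submodule.map_top, Submodule.range_mkQ, Submodule.mkQ_map_self, sup_bot_eq,
    Submodule.map_span, ← Set.range_comp] at this
  exact this.ge

theorem NormalSpans.truncDim_le {m : Fin d → List (Fin d)} {f : NCPowerSeries d} {n : ℕ}
    (hf : NormalSpans m f n) : truncDim f n ≤ (normalLT m n).card := by
  have h := finrank_range_le_card (R := ℂ)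
    (fun w : normalLT m n => (relationsMod f n).mkQ (monomial w.1))
  rw [Set.finrank, top_le_iff.mp hf.top_le_span, finrank_top] at h
  simpa [truncDim] using h

/-- The dimension count makes the spanning normal words a basis. Left multiplication by `x` maps the
shorter ones injectively into this basis, so a normal form of `g` killed by `x` has zero
coefficients. This supplies the injectivity hypothesis of `truncDim_succ_ge`. -/
theorem NormalSpans.mem_of_mul_mem {m : Fin d → List (Fin d)} {f : NCPowerSeries d} {n : ℕ}
    {x : Fin d} (hx : ∀ w, IsNormal m w → IsNormal m (x :: w))
    (hf : NormalSpans m f (n + 1)) (hdim : truncDim f (n + 1) = (normalLT m (n + 1)).card)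
    {g : NCPowerSeries d} (hg : monomial [x] * g ∈ relationsMod f (n + 1)) :
    g ∈ relationsMod f n := by
  have hli := linearIndependent_of_top_le_span_of_card_eq_finrank hf.top_le_span
    (by rw [Fintype.card_coe]; exact hdim.symm)
  let shift : normalLT m n → normalLT m (n + 1) := fun w =>
    ⟨x :: w.1, mem_normalLT.mpr ⟨by simpa using (mem_normalLT.mp w.2).1,
      hx _ (mem_normalLT.mp w.2).2⟩⟩
  have hshift : Function.Injective shift := fun u v h => by
    exact Subtype.ext (List.cons.inj (congrArg Subtype.val h)).2
  have hli' := Fintype.linearIndependent_iff.mp (hli.comp shift hshift)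
  have hgtop : g ∈ (⊤ : Submodule ℂ (NCPowerSeries d)) := trivial
  rw [← hf.anti (Nat.le_succ n)] at hgtop
  obtain ⟨y, hy, z, hz, rfl⟩ := Submodule.mem_sup.mp hgtop
  obtain ⟨c, rfl⟩ := (Submodule.mem_span_range_iff_exists_fun ℂ).mp hy
  have hxz : monomial [x] * z ∈ relationsMod f (n + 1) :=
    mul_mem_relationsMod_of_le (by omega) (monomial_mem_orderGE (n := 1) le_rfl) hz
  have h0 := sub_mem hg hxz
  rw [mul_add, add_sub_cancel_right, Finset.mul_sum] at h0
  have hc := hli' c (by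
    rw [← (Submodule.Quotient.mk_eq_zero _).mpr h0]
    change _ = (relationsMod f (n + 1)).mkQ _
    rw [map_sum]
    refine Finset.sum_congr rfl fun w _ => ?_
    rw [mul_smul_comm, ← monomial_cons, map_smul]
    rfl)
  simpa [hc] using hz

/-! ### Leading words of the model and the count of normal words. -/

/-- The leading words of the cyclic derivatives of the model potential `∑ yᵢ y_{π i} x^{q+1}`,
where `x` is the letter `0`. -/
def leadWord [NeZero d] (π : Equiv.Perm (Fin d)) (a : Fin d) (q : ℕ) (j : Fin d) : List (Fin d) :=
  if j = 0 then a :: π a :: List.replicate q 0 else π j :: List.replicate (q + 1) 0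

theorem leadWord_zero [NeZero d] (π : Equiv.Perm (Fin d)) (a : Fin d) (q : ℕ) :
    leadWord π a q 0 = a :: π a :: List.replicate q 0 := if_pos rfl

theorem leadWord_of_ne [NeZero d] (π : Equiv.Perm (Fin d)) (a : Fin d) (q : ℕ) {j : Fin d}
    (hj : j ≠ 0) : leadWord π a q j = π j :: List.replicate (q + 1) 0 := if_neg hj

theorem length_leadWord [NeZero d] (π : Equiv.Perm (Fin d)) (a : Fin d) (q : ℕ) (j : Fin d) :
    (leadWord π a q j).length = q + 2 := by
  unfold leadWord
  split_ifs <;> simp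

section

variable [NeZero d] {π : Equiv.Perm (Fin d)} {a : Fin d} {q : ℕ}

theorem perm_ne_zero (hπ : π 0 = 0) {j : Fin d} (hj : j ≠ 0) : π j ≠ 0 := fun h =>
  hj (π.injective (h.trans hπ.symm))

/-- No leading word starts with the letter `0`. -/
theorem isNormal_zero_cons (hπ : π 0 = 0) (ha : a ≠ 0) {w : List (Fin d)}
    (hw : IsNormal (leadWord π a q) w) : IsNormal (leadWord π a q) (0 :: w) := by
  refine isNormal_cons.mpr ⟨fun j hj => ?_, hw⟩
  by_cases h : j = 0
  · rw [h, leadWord_zero, List.cons_prefix_cons] at hj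
    exact ha hj.1
  · rw [leadWord_of_ne _ _ _ h, List.cons_prefix_cons] at hj
    exact perm_ne_zero hπ h hj.1

theorem isNormal_replicate_append (hπ : π 0 = 0) (ha : a ≠ 0) {w : List (Fin d)}
    (hw : IsNormal (leadWord π a q) w) (r : ℕ) :
    IsNormal (leadWord π a q) (List.replicate r 0 ++ w) := by
  induction r with
  | zero => exact hw
  | succ r ih => exact isNormal_zero_cons hπ ha ih

/-- Two leading words could be a prefix here: `leadWord π a q 0`, whose overlap with itself `hov`
excludes, and `π a` followed by `q + 1` zeros, which would need `w` to start with `0`. -/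
theorem isNormal_tail_leadWord_zero (hπ : π 0 = 0) (ha : a ≠ 0) (hov : π a ≠ a ∨ q ≠ 0)
    {w : List (Fin d)} (hw : IsNormal (leadWord π a q) w) (h0 : ∀ v, w ≠ 0 :: v) :
    IsNormal (leadWord π a q) (π a :: (List.replicate q 0 ++ w)) := by
  refine isNormal_cons.mpr ⟨fun j hj => ?_, isNormal_replicate_append hπ ha hw q⟩
  by_cases h : j = 0
  · rw [h, leadWord_zero, List.cons_prefix_cons] at hj
    rcases hov with hov | hov
    · exact hov hj.1.symm
    · obtain ⟨r, rfl⟩ := Nat.exists_eq_succ_of_ne_zero hov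
      rw [List.replicate_succ, List.cons_append, List.cons_prefix_cons] at hj
      exact perm_ne_zero hπ ha hj.2.1
  · rw [leadWord_of_ne _ _ _ h, List.cons_prefix_cons, List.replicate_succ',
      List.prefix_append_right_inj] at hj
    cases w with
    | nil => simp at hj
    | cons l v =>
      rw [List.cons_prefix_cons] at hj
      exact h0 v (by rw [hj.2.1])

theorem leadWord_append_injective (hπ : π 0 = 0) (ha : a ≠ 0) :
    Function.Injective fun p : Fin d × List (Fin d) => leadWord π a q p.1 ++ p.2 := by
  rintro ⟨i, u⟩ ⟨j, v⟩ h
  obtain ⟨h1, rfl⟩ := List.append_inj h (by rw [length_leadWord, length_leadWord])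
  suffices i = j by rw [this]
  dsimp only at h1
  by_cases hi : i = 0 <;> by_cases hj : j = 0
  · rw [hi, hj]
  · rw [hi, leadWord_zero, leadWord_of_ne _ _ _ hj, List.replicate_succ] at h1
    simp only [List.cons.injEq] at h1
    exact absurd h1.2.1 (perm_ne_zero hπ ha)
  · rw [hj, leadWord_zero, leadWord_of_ne _ _ _ hi, List.replicate_succ] at h1
    simp only [List.cons.injEq] at h1
    exact absurd h1.2.1.symm (perm_ne_zero hπ ha)
  · rw [leadWord_of_ne _ _ _ hi, leadWord_of_ne _ _ _ hj] at h1
    simp only [List.cons.injEq] at h1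
    exact π.injective h1.1

/-- The number of normal words satisfies (half of) the recursion with characteristic series
`1 - dt + dt^{k-1} - t^k`. -/
theorem card_normalLT_succ_le (hπ : π 0 = 0) (ha : a ≠ 0) (hov : π a ≠ a ∨ q ≠ 0) (n : ℕ) :
    (normalLT (leadWord π a q) (n + 1)).card + d * (normalLT (leadWord π a q) (n - (q + 1))).card ≤
      1 + d * (normalLT (leadWord π a q) n).card +
        (normalLT (leadWord π a q) (n - (q + 1) - 1)).card := by
  classical
  set m := leadWord π a q with hm
  set p := n - (q + 1) with hp
  let A := (Finset.univ ×ˢ normalLT m p).image fun x : Fin d × List (Fin d) => m x.1 ++ x.2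
  let B := (Finset.univ ×ˢ normalLT m n).image fun x : Fin d × List (Fin d) => x.1 :: x.2
  let C := (normalLT m (p - 1)).image fun v => m 0 ++ 0 :: v
  have hA : A.card = d * (normalLT m p).card := by
    rw [Finset.card_image_of_injective _ (leadWord_append_injective hπ ha), Finset.card_product,
      Finset.card_univ, Fintype.card_fin]
  have hB : B.card ≤ d * (normalLT m n).card := by
    refine Finset.card_image_le.trans ?_
    rw [Finset.card_product, Finset.card_univ, Fintype.card_fin]
  have hC : C.card ≤ (normalLT m (p - 1)).card := Finset.card_image_le
  have hdisj : Disjoint (normalLT m (n + 1)) A := by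
    rw [Finset.disjoint_right]
    intro w hw hw'
    obtain ⟨x, -, rfl⟩ := Finset.mem_image.mp hw
    exact (mem_normalLT.mp hw').2 x.1 (List.prefix_append _ _).isInfix
  -- `A` holds the leading words followed by a normal word. Deleting the first letter leaves a
  -- normal word (set `B`), except where `m 0` is followed by the letter `0` (set `C`).
  have hsub : normalLT m (n + 1) ∪ A ⊆ {[]} ∪ B ∪ C := by
    refine Finset.union_subset (fun w hw => ?_) fun w hw => ?_
    · rw [mem_normalLT] at hw
      cases w with
      | nil => simp
      | cons l w =>
        refine Finset.mem_union_left _ (Finset.mem_union_right _ ?_)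
        exact Finset.mem_image.mpr ⟨(l, w), Finset.mem_product.mpr ⟨Finset.mem_univ _,
          mem_normalLT.mpr ⟨by simpa using hw.1, (isNormal_cons.mp hw.2).2⟩⟩, rfl⟩
    · obtain ⟨⟨j, v⟩, hx, rfl⟩ := Finset.mem_image.mp hw
      obtain ⟨hvp, hv⟩ := mem_normalLT.mp (Finset.mem_product.mp hx).2
      dsimp only at hvp hv ⊢
      have hB' : ∀ (l : Fin d) (w : List (Fin d)), w.length = q + 1 + v.length → IsNormal m w →
          l :: w ∈ {[]} ∪ B ∪ C := fun l w hl hw =>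
        Finset.mem_union_left _ (Finset.mem_union_right _ (Finset.mem_image.mpr ⟨(l, w),
          Finset.mem_product.mpr ⟨Finset.mem_univ _, mem_normalLT.mpr ⟨by dsimp only; omega, hw⟩⟩, rfl⟩))
      by_cases hj : j = 0
      · subst hj
        by_cases hv0 : ∃ v', v = 0 :: v'
        · obtain ⟨v', rfl⟩ := hv0
          refine Finset.mem_union_right _ (Finset.mem_image.mpr ⟨v', mem_normalLT.mpr
            ⟨by simp at hvp; omega, (isNormal_cons.mp hv).2⟩, rfl⟩)
        · rw [hm, leadWord_zero]
          refine hB' _ _ (by simp; omega) ?_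
          exact isNormal_tail_leadWord_zero hπ ha hov hv (not_exists.mp hv0)
      · rw [hm, leadWord_of_ne _ _ _ hj]
        exact hB' _ _ (by simp) (isNormal_replicate_append hπ ha hv _)
  have h := Finset.card_le_card hsub
  rw [Finset.card_union_of_disjoint hdisj] at h
  have h1 := Finset.card_union_le ({[]} ∪ B) C
  have h2 := Finset.card_union_le ({[]} : Finset (List (Fin d))) B
  rw [Finset.card_singleton] at h2
  omega

theorem NormalSpans.truncDim_succ_ge (hπ : π 0 = 0) (ha : a ≠ 0)
    {f : NCPowerSeries d} (hf : f ∈ orderGE d (q + 3)) {n : ℕ}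
    (hn : NormalSpans (leadWord π a q) f n)
    (hdim : ∀ j ≤ n, truncDim f j = (normalLT (leadWord π a q) j).card) :
    1 + d * (normalLT (leadWord π a q) n).card +
        (normalLT (leadWord π a q) (n - (q + 1) - 1)).card ≤
      truncDim f (n + 1) + d * (normalLT (leadWord π a q) (n - (q + 1))).card := by
  have h := NCPowerSeries.truncDim_succ_ge (k := q + 1) (p := n - (q + 1)) (n := n) hf (by omega) (by
    intro g hg
    rcases Nat.eq_zero_or_pos (n - (q + 1)) with h0 | h0
    · rw [h0, Nat.zero_sub, relationsMod_zero]
      trivial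
    · obtain ⟨r, hr⟩ := Nat.exists_eq_succ_of_ne_zero h0.ne'
      rw [hr] at hg ⊢
      exact (hn.anti (by omega)).mem_of_mul_mem (fun w => isNormal_zero_cons hπ ha)
        (hdim (r + 1) (by omega)) (hg 0))
  rwa [hdim n le_rfl, hdim (n - (q + 1)) (by omega), hdim (n - (q + 1) - 1) (by omega)] at h

/-- Spanning gives one inequality. For the other, the algebraic recursion bounds the next dimension
below by the same expression that bounds the next count of normal words above. -/
theorem NormalSpans.truncDim_eq (hπ : π 0 = 0) (ha : a ≠ 0) (hov : π a ≠ a ∨ q ≠ 0)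
    {f : NCPowerSeries d} (hf : f ∈ orderGE d (q + 3)) {n : ℕ}
    (hn : NormalSpans (leadWord π a q) f n) :
    truncDim f n = (normalLT (leadWord π a q) n).card := by
  induction n using Nat.strong_induction_on with
  | _ n ih =>
    cases n with
    | zero => rw [truncDim_zero, normalLT_zero, Finset.card_empty]
    | succ n =>
      refine le_antisymm hn.truncDim_le ?_
      have h1 := card_normalLT_succ_le hπ ha hov n
      have h2 := (hn.anti (Nat.le_succ n)).truncDim_succ_ge hπ ha hf
        fun j hj => ih j (by omega) (hn.anti (by omega))
      omega

/-- When the normal words span, their number satisfies the recursion exactly. -/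
theorem NormalSpans.card_normalLT_succ (hπ : π 0 = 0) (ha : a ≠ 0) (hov : π a ≠ a ∨ q ≠ 0)
    {f : NCPowerSeries d} (hf : f ∈ orderGE d (q + 3)) {n : ℕ}
    (hn : NormalSpans (leadWord π a q) f (n + 1)) :
    (normalLT (leadWord π a q) (n + 1)).card + d * (normalLT (leadWord π a q) (n - (q + 1))).card =
      1 + d * (normalLT (leadWord π a q) n).card +
        (normalLT (leadWord π a q) (n - (q + 1) - 1)).card := by
  have hdim : ∀ j ≤ n + 1, truncDim f j = (normalLT (leadWord π a q) j).card := fun j hj =>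
    (hn.anti hj).truncDim_eq hπ ha hov hf
  refine le_antisymm (card_normalLT_succ_le hπ ha hov n) ?_
  have h := (hn.anti (Nat.le_succ n)).truncDim_succ_ge hπ ha hf
    fun j hj => hdim j (hj.trans (Nat.le_succ n))
  rwa [hdim (n + 1) le_rfl] at h

end

end NCPowerSeries

/-! ### Semicontinuity of rank along a line. -/

section

variable {U ι : Type*} [AddCommGroup U] [Module ℂ U]

open Polynomial in
/-- A matrix `1 + sW` is nonsingular for all but finitely many `s`. -/
theorem eventually_det_one_add_smul_ne_zero {r : ℕ} (W : Matrix (Fin r) (Fin r) ℂ) :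
    ∀ᶠ s : ℂ in Filter.cofinite, (1 + s • W).det ≠ 0 := by
  let P : ℂ[X] := (1 + (X : ℂ[X]) • W.map C).det
  have hP : ∀ s, P.eval s = (1 + s • W).det := by
    intro s
    change Polynomial.evalRingHom s P = _
    rw [RingHom.map_det]
    congr 1
    ext i j
    by_cases h : i = j <;> simp [h, mul_comm s]
  have hP0 : P ≠ 0 := by
    intro h
    have := hP 0
    simp [h] at this
  refine (Polynomial.finite_setOfPred_isRoot hP0).subset fun s hs => ?_
  simpa [Polynomial.IsRoot, hP] using hs

/-- Lower semicontinuity of the rank of a family of vectors along a line. -/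
theorem eventually_finrank_span_le [Module.Finite ℂ U] (v w : ι → U) :
    ∀ᶠ s : ℂ in Filter.cofinite, Module.finrank ℂ (Submodule.span ℂ (Set.range v)) ≤
      Module.finrank ℂ (Submodule.span ℂ (Set.range fun i => v i + s • w i)) := by
  obtain ⟨e, he, -, hli⟩ := Submodule.exists_fun_fin_finrank_span_eq ℂ (Set.range v)
  choose c hc using he
  -- In the coordinates `L`, the chosen independent vectors form the identity matrix, and their
  -- perturbations the matrix `1 + sW`.
  obtain ⟨L, hL⟩ := LinearMap.exists_leftInverse_of_injective
    (Fintype.linearCombination ℂ e) (LinearMap.ker_eq_bot.mpr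
      (linearIndependent_iff_injective_fintypeLinearCombination.mp hli))
  have hLe : ∀ i, L (e i) = Pi.single i 1 := by
    intro i
    have := LinearMap.congr_fun hL (Pi.single i 1)
    simpa [Fintype.linearCombination_apply_single] using this
  filter_upwards [eventually_det_one_add_smul_ne_zero (Matrix.of fun i j => L (w (c i)) j)] with s hs
  have hrows := Matrix.linearIndependent_rows_of_det_ne_zero hs
  have hli' : LinearIndependent ℂ fun i => v (c i) + s • w (c i) := by
    refine LinearIndependent.of_comp L ?_
    have heq : (L ∘ fun i => v (c i) + s • w (c i)) =
        (1 + s • Matrix.of fun i j => L (w (c i)) j).row := by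
      funext i j
      simp [hc, hLe, Matrix.one_apply, Pi.single_apply, eq_comm]
    rw [heq]
    exact hrows
  have hspan := finrank_span_eq_card hli'
  rw [Fintype.card_fin] at hspan
  rw [← hspan]
  refine Submodule.finrank_mono (Submodule.span_mono ?_)
  rintro _ ⟨i, rfl⟩
  exact ⟨c i, rfl⟩

theorem finrank_quotient_span_sup (K : Submodule ℂ U) [Module.Finite ℂ (U ⧸ K)] (v : ι → U) :
    Module.finrank ℂ (U ⧸ (Submodule.span ℂ (Set.range v) ⊔ K)) +
      Module.finrank ℂ (Submodule.span ℂ (Set.range fun i => K.mkQ (v i))) =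
      Module.finrank ℂ (U ⧸ K) := by
  rw [sup_comm, ← (Submodule.quotientQuotientEquivQuotientSup K _).finrank_eq, Submodule.map_span,
    ← Set.range_comp]
  exact Submodule.finrank_quotient_add_finrank _

/-- Upper semicontinuity of the codimension, relative to a fixed subspace, of the span of a family
of vectors along a line. -/
theorem eventually_finrank_quotient_le (K : Submodule ℂ U) [Module.Finite ℂ (U ⧸ K)]
    (v w : ι → U) :
    ∀ᶠ s : ℂ in Filter.cofinite,
      Module.finrank ℂ (U ⧸ (Submodule.span ℂ (Set.range fun i => v i + s • w i) ⊔ K)) ≤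
        Module.finrank ℂ (U ⧸ (Submodule.span ℂ (Set.range v) ⊔ K)) := by
  filter_upwards [eventually_finrank_span_le (fun i => K.mkQ (v i)) (fun i => K.mkQ (w i))]
    with s hs
  have h1 := finrank_quotient_span_sup K v
  have h2 := finrank_quotient_span_sup K fun i => v i + s • w i
  have heq : (fun i => K.mkQ (v i + s • w i)) = fun i => K.mkQ (v i) + s • K.mkQ (w i) := by
    funext i
    rw [map_add, map_smul]
  rw [heq] at h2
  omega

theorem span_range_smul {c : ℂ} (hc : c ≠ 0) (v : ι → U) :
    Submodule.span ℂ (Set.range fun i => c • v i) = Submodule.span ℂ (Set.range v) := by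
  refine le_antisymm (Submodule.span_le.mpr ?_) (Submodule.span_le.mpr ?_)
  · rintro _ ⟨i, rfl⟩
    exact Submodule.smul_mem _ _ (Submodule.subset_span ⟨i, rfl⟩)
  · rintro _ ⟨i, rfl⟩
    have := Submodule.smul_mem _ c⁻¹ (Submodule.subset_span (R := ℂ)
      (Set.mem_range_self (f := fun i => c • v i) i))
    simpa [smul_smul, inv_mul_cancel₀ hc] using this

/-- The same line seen from infinity: `v + s w = s (w + s⁻¹ v)`, and inversion preserves cofinite
sets. -/
theorem eventually_finrank_quotient_le' (K : Submodule ℂ U) [Module.Finite ℂ (U ⧸ K)]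
    (v w : ι → U) :
    ∀ᶠ s : ℂ in Filter.cofinite,
      Module.finrank ℂ (U ⧸ (Submodule.span ℂ (Set.range fun i => v i + s • w i) ⊔ K)) ≤
        Module.finrank ℂ (U ⧸ (Submodule.span ℂ (Set.range w) ⊔ K)) := by
  have h := (inv_injective (G := ℂ)).tendsto_cofinite.eventually
    (eventually_finrank_quotient_le K w v)
  filter_upwards [h, (Set.finite_singleton (0 : ℂ)).compl_mem_cofinite] with s hs hs0
  have hs0 : s ≠ 0 := hs0
  have heq : (fun i => s • (w i + s⁻¹ • v i)) = fun i => v i + s • w i := by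
    funext i
    rw [smul_add, smul_smul, mul_inv_cancel₀ hs0, one_smul, add_comm]
  rwa [← span_range_smul hs0, heq] at hs

theorem eventually_span_sup_eq_top (K : Submodule ℂ U) [Module.Finite ℂ (U ⧸ K)] (v : ι → U)
    {w : ι → U} (h : Submodule.span ℂ (Set.range w) ⊔ K = ⊤) :
    ∀ᶠ s : ℂ in Filter.cofinite,
      Submodule.span ℂ (Set.range fun i => v i + s • w i) ⊔ K = ⊤ := by
  filter_upwards [eventually_finrank_quotient_le' K v w] with s hs
  have h0 : Module.finrank ℂ (U ⧸ (⊤ : Submodule ℂ U)) = 0 := Module.finrank_zero_of_subsingleton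
  rw [h, h0, Nat.le_zero] at hs
  have hfin := Module.Finite.of_surjective _ (Submodule.factor_surjective
    (le_sup_right : K ≤ Submodule.span ℂ (Set.range fun i => v i + s • w i) ⊔ K))
  exact Submodule.Quotient.subsingleton_iff.mp (Module.finrank_zero_iff.mp hs)

end

namespace NCPowerSeries

variable {d : ℕ}

/-! ### Generic perturbation of a potential. -/

theorem relation_add_smul (f g : NCPowerSeries d) (s : ℂ) (p) :
    relation (f + s • g) p = relation f p + s • relation g p := by
  simp [relation, cyclicDeriv_add, cyclicDeriv_smul, mul_add, add_mul]

theorem relationSpan_add_smul (f g : NCPowerSeries d) (s : ℂ) :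
    relationSpan (f + s • g) =
      Submodule.span ℂ (Set.range fun p => relation f p + s • relation g p) := by
  simp only [relationSpan, ← relation_add_smul]

theorem eventually_truncDim_le (f g : NCPowerSeries d) (n : ℕ) :
    ∀ᶠ s : ℂ in Filter.cofinite, truncDim (f + s • g) n ≤ truncDim f n := by
  filter_upwards [eventually_finrank_quotient_le (orderGE d n) (relation f) (relation g)] with s hs
  rw [← relationSpan_add_smul] at hs
  exact hs

/-- With the normal words placed in the fixed subspace, spanning says that the relations have
codimension zero, which is an open condition. -/
theorem NormalSpans.eventually {m : Fin d → List (Fin d)} {g : NCPowerSeries d} {n : ℕ}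
    (hg : NormalSpans m g n) (f : NCPowerSeries d) :
    ∀ᶠ s : ℂ in Filter.cofinite, NormalSpans m (f + s • g) n := by
  set N := Submodule.span ℂ (Set.range fun w : normalLT m n => monomial (d := d) w.1)
  have hfin : Module.Finite ℂ (NCPowerSeries d ⧸ (N ⊔ orderGE d n)) :=
    Module.Finite.of_surjective (Submodule.factor (le_sup_right : orderGE d n ≤ N ⊔ orderGE d n))
      (Submodule.factor_surjective _)
  filter_upwards [eventually_span_sup_eq_top (N ⊔ orderGE d n) (relation f) (w := relation g)
    (by rw [sup_left_comm]; exact hg)] with s hs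
  rwa [← relationSpan_add_smul, sup_left_comm] at hs

/-! ### The model potential and its rewriting system. -/

section

variable [NeZero d] {π : Equiv.Perm (Fin d)} {a : Fin d} {q : ℕ}

/-- The model potential `∑ yᵢ y_{π i} x^{q+1}`, where `x` is the letter `0` and the `yᵢ` are the
other letters. -/
def modelPotential (π : Equiv.Perm (Fin d)) (q : ℕ) : NCPowerSeries d :=
  open Classical in
  mk fun w => if ∃ i, i ≠ 0 ∧ w = i :: π i :: List.replicate (q + 1) 0 then 1 else 0

theorem coeff_modelPotential_of_ne {w : List (Fin d)} (h : coeff w (modelPotential π q) ≠ 0) :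
    ∃ i, i ≠ 0 ∧ w = i :: π i :: List.replicate (q + 1) 0 := by
  by_contra hw
  exact h (if_neg hw)

theorem modelPotential_mem : modelPotential π q ∈ orderGE d (q + 3) := by
  intro w hw
  by_contra h
  obtain ⟨i, -, rfl⟩ := coeff_modelPotential_of_ne h
  simp at hw

/-- The coefficient counts rotations, so it is a natural number and nothing cancels. -/
theorem coeff_cyclicDeriv_modelPotential_ne_zero {j : Fin d} {w : List (Fin d)} {r : ℕ}
    (hr : r < w.length + 1) {i : Fin d} (hi : i ≠ 0)
    (h : (j :: w).rotate r = i :: π i :: List.replicate (q + 1) 0) :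
    coeff w (cyclicDeriv j (modelPotential π q)) ≠ 0 := by
  classical
  have hsum : coeff w (cyclicDeriv j (modelPotential π q)) =
      ((∑ r ∈ Finset.range (w.length + 1), if ∃ i, i ≠ 0 ∧
        (j :: w).rotate r = i :: π i :: List.replicate (q + 1) 0 then 1 else 0 : ℕ) : ℂ) := by
    simp only [cyclicDeriv, strikeOff, sym, modelPotential, coeff_mk, List.length_cons]
    push_cast
    exact Finset.sum_congr rfl fun r _ => by congr
  rw [hsum, Nat.cast_ne_zero]
  refine (Finset.sum_pos' (fun _ _ => Nat.zero_le _) ⟨r, Finset.mem_range.mpr hr, ?_⟩).ne'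
  rw [if_pos ⟨i, hi, h⟩]
  exact Nat.one_pos

theorem coeff_leadWord_ne_zero (ha : a ≠ 0) (j : Fin d) :
    coeff (leadWord π a q j) (cyclicDeriv j (modelPotential π q)) ≠ 0 := by
  by_cases hj : j = 0
  · rw [hj, leadWord_zero]
    refine coeff_cyclicDeriv_modelPotential_ne_zero (r := 1) (by simp) ha ?_
    simp [List.replicate_succ']
  · rw [leadWord_of_ne _ _ _ hj]
    exact coeff_cyclicDeriv_modelPotential_ne_zero (r := 0) (by simp) hj (List.rotate_zero _)

/-- The weight of a letter in the order of words: the letter `0` is smallest, `a` largest. -/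
def letterWeight (a l : Fin d) : ℕ := if l = 0 then 0 else if l = a then 2 else 1

/-- The number with base three digits the weights of the letters. -/
def wordWeight (a : Fin d) : List (Fin d) → ℕ
  | [] => 0
  | l :: w => letterWeight a l * 3 ^ w.length + wordWeight a w

theorem wordWeight_cons (a l : Fin d) (w : List (Fin d)) :
    wordWeight a (l :: w) = letterWeight a l * 3 ^ w.length + wordWeight a w := rfl

theorem letterWeight_le (a l : Fin d) : letterWeight a l ≤ 2 := by
  unfold letterWeight
  split_ifs <;> omega

theorem wordWeight_lt (a : Fin d) (w : List (Fin d)) : wordWeight a w < 3 ^ w.length := by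
  induction w with
  | nil => simp [wordWeight]
  | cons l w ih =>
    have := Nat.mul_le_mul_right (3 ^ w.length) (letterWeight_le a l)
    rw [wordWeight, List.length_cons, pow_succ]
    omega

theorem wordWeight_append (a : Fin d) (u v : List (Fin d)) :
    wordWeight a (u ++ v) = wordWeight a u * 3 ^ v.length + wordWeight a v := by
  induction u with
  | nil => simp [wordWeight]
  | cons l u ih =>
    rw [List.cons_append, wordWeight, ih, wordWeight, List.length_append, pow_add]
    ring

theorem wordWeight_replicate_append (a : Fin d) (r : ℕ) (w : List (Fin d)) :
    wordWeight a (List.replicate r 0 ++ w) = wordWeight a w := by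
  induction r with
  | zero => rfl
  | succ r ih => simp [List.replicate_succ, wordWeight, ih, letterWeight]

theorem wordWeight_append_lt {a : Fin d} (u v : List (Fin d)) {w w' : List (Fin d)}
    (hl : w'.length = w.length) (h : wordWeight a w' < wordWeight a w) :
    wordWeight a (u ++ w' ++ v) < wordWeight a (u ++ w ++ v) := by
  simp only [wordWeight_append, hl]
  gcongr

/-- The leading word of each cyclic derivative of the model potential has the largest weight. -/
theorem eq_leadWord_or_wordWeight_lt (hπ : π 0 = 0) (ha : a ≠ 0) {j : Fin d} {w : List (Fin d)}
    (h : coeff w (cyclicDeriv j (modelPotential π q)) ≠ 0) :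
    w = leadWord π a q j ∨
      w.length = q + 2 ∧ wordWeight a w < wordWeight a (leadWord π a q j) := by
  have hsum : ∑ r ∈ Finset.range (j :: w).length,
      coeff ((j :: w).rotate r) (modelPotential π q) ≠ 0 := h
  obtain ⟨r, -, hr⟩ := Finset.exists_ne_zero_of_sum_ne_zero hsum
  obtain ⟨i, hi, hri⟩ := coeff_modelPotential_of_ne hr
  have hrot : (i :: π i :: List.replicate (q + 1) 0) ~r (j :: w) := by
    rw [List.isRotated_comm]
    exact ⟨r, hri⟩
  obtain ⟨n, hn, hnw⟩ := List.isRotated_iff_mod.mp hrot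
  have hlen : w.length = q + 2 := by
    have := congrArg List.length hnw
    simp at this
    omega
  have key0 : i = j → π i :: List.replicate (q + 1) 0 = w → w = leadWord π a q j := by
    rintro rfl rfl
    rw [leadWord_of_ne _ _ _ hi]
  have hlow : ∀ l : Fin d, l ≠ 0 → 1 ≤ letterWeight a l := by
    intro l hl
    rw [letterWeight, if_neg hl]
    split_ifs <;> omega
  -- Cases by the position of the deleted letter. Deleting `i` (rotation by `0` or by the full
  -- length) gives a leading word. Deleting `π i` gives `0^{q+1} i`, of weight below `3`. Deleting a
  -- zero gives `0^{q-n} i (π i) 0^n`, which is heaviest when `n = q` and `i = a`.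
  rcases n with _ | _ | n
  · rw [List.rotate_zero, List.cons.injEq] at hnw
    exact Or.inl (key0 hnw.1 hnw.2)
  · rw [List.rotate_cons_succ, List.rotate_zero, List.cons_append, List.cons.injEq] at hnw
    obtain ⟨rfl, rfl⟩ := hnw
    refine Or.inr ⟨hlen, ?_⟩
    rw [leadWord_of_ne _ _ _ (perm_ne_zero hπ hi), wordWeight_replicate_append]
    have h1 := wordWeight_lt a [i]
    have h2 := Nat.mul_le_mul_right (3 ^ (q + 1)) (hlow _ (perm_ne_zero hπ (perm_ne_zero hπ hi)))
    have h3 : 3 ^ 1 ≤ 3 ^ (q + 1) := Nat.pow_le_pow_right (by norm_num) (by omega)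
    rw [wordWeight_cons a (π (π i)), List.length_replicate]
    simp only [List.length_singleton] at h1
    omega
  · simp only [List.length_cons, List.length_replicate] at hn
    have hnw' : List.replicate (q + 1 - n) 0 ++ i :: π i :: List.replicate n 0 = j :: w := by
      rw [← hnw, List.rotate_cons_succ, List.cons_append, List.rotate_cons_succ,
        List.rotate_eq_drop_append_take (by simp; omega)]
      have h1 : n - (q + 1) = 0 := by omega
      simp [List.drop_append, List.take_append, h1, Nat.min_eq_left (show n ≤ q + 1 by omega)]
    rcases (show n ≤ q + 1 by omega).eq_or_lt with rfl | hnq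
    · rw [Nat.sub_self, List.replicate_zero, List.nil_append, List.cons.injEq] at hnw'
      exact Or.inl (key0 hnw'.1 hnw'.2)
    · rw [show q + 1 - n = q - n + 1 by omega, List.replicate_succ, List.cons_append,
        List.cons.injEq] at hnw'
      obtain ⟨rfl, rfl⟩ := hnw'
      rw [leadWord_zero, wordWeight_replicate_append]
      have hlead : 2 * 3 ^ (q + 1) ≤ wordWeight a (a :: π a :: List.replicate q 0) := by
        rw [wordWeight_cons]
        simp [letterWeight, ha]
      rcases (show n ≤ q by omega).eq_or_lt with rfl | hnq'
      · rw [Nat.sub_self, List.replicate_zero, List.nil_append]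
        by_cases hia : i = a
        · exact Or.inl (by rw [hia])
        · refine Or.inr ⟨by simp, lt_of_lt_of_le ?_ hlead⟩
          have h1 := wordWeight_lt a (π i :: List.replicate n 0)
          rw [wordWeight_cons, letterWeight, if_neg hi, if_neg hia]
          simp only [List.length_cons, List.length_replicate] at h1 ⊢
          omega
      · refine Or.inr ⟨hlen, lt_of_lt_of_le ?_ hlead⟩
        have h1 := wordWeight_lt a (i :: π i :: List.replicate n 0)
        have h2 : 3 ^ (n + 1 + 1) ≤ 3 ^ (q + 1) := Nat.pow_le_pow_right (by norm_num) (by omega)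
        simp only [List.length_cons, List.length_replicate] at h1
        omega

/-- Each relation replaces a leading word inside a word by words of the same length and smaller
weight. The weight is a natural number, so the rewriting stops. -/
theorem normalSpans_modelPotential (hπ : π 0 = 0) (ha : a ≠ 0) (n : ℕ) :
    NormalSpans (leadWord π a q) (modelPotential π q) n := by
  classical
  set f := modelPotential π q with hf
  set S := Submodule.span ℂ (Set.range fun w : normalLT (leadWord π a q) n => monomial w.1) ⊔
    relationsMod f n with hS
  have key : ∀ (N : ℕ) (w : List (Fin d)), wordWeight a w = N → monomial w ∈ S := by
    intro N
    induction N using Nat.strong_induction_on with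
    | _ N ih =>
      intro w hw
      by_cases hl : w.length < n
      swap
      · exact Submodule.mem_sup_right (orderGE_le f n (monomial_mem_orderGE (not_lt.mp hl)))
      by_cases hnor : IsNormal (leadWord π a q) w
      · exact Submodule.mem_sup_left (Submodule.subset_span ⟨⟨w, mem_normalLT.mpr ⟨hl, hnor⟩⟩, rfl⟩)
      obtain ⟨j, u, v, huv⟩ : ∃ j, leadWord π a q j <:+: w := by simpa [IsNormal] using hnor
      -- The derivative is homogeneous of degree `q + 2`, so it is a finite sum of monomials.
      have htrunc : cyclicDeriv j f = trunc (q + 3) (cyclicDeriv j f) := by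
        ext w'
        rw [coeff_trunc]
        split_ifs with hw'
        · rfl
        · by_contra hne
          rcases eq_leadWord_or_wordWeight_lt hπ ha hne with h | h
          · rw [h, length_leadWord] at hw'
            omega
          · omega
      have hrel := relation_mem f n (u, j, v)
      simp only [relation] at hrel
      rw [htrunc, trunc, Finset.mul_sum, Finset.sum_mul,
        ← Finset.add_sum_erase _ _ (mem_wordsLT.mpr (by rw [length_leadWord]; omega) :
          leadWord π a q j ∈ wordsLT d (q + 3))] at hrel
      simp only [mul_smul_comm, smul_mul_assoc, ← monomial_append] at hrel
      rw [huv] at hrel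
      have hrest : ∑ w' ∈ (wordsLT d (q + 3)).erase (leadWord π a q j),
          coeff w' (cyclicDeriv j f) • monomial (u ++ w' ++ v) ∈ S := by
        refine sum_mem fun w' hw' => ?_
        by_cases hc : coeff w' (cyclicDeriv j f) = 0
        · rw [hc, zero_smul]
          exact zero_mem _
        · refine Submodule.smul_mem _ _ (ih _ ?_ _ rfl)
          rcases eq_leadWord_or_wordWeight_lt hπ ha hc with h | h
          · exact absurd h (Finset.ne_of_mem_erase hw')
          · rw [← hw, ← huv]
            exact wordWeight_append_lt u v (by rw [h.1, length_leadWord]) h.2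
      have hmem := sub_mem (Submodule.mem_sup_right hrel : _ ∈ S) hrest
      rw [add_sub_cancel_right] at hmem
      exact (Submodule.smul_mem_iff _ (coeff_leadWord_ne_zero ha j)).mp hmem
  refine top_le_iff.mp fun g _ => ?_
  rw [← sub_add_cancel g (trunc n g)]
  refine add_mem (Submodule.mem_sup_right (orderGE_le f n (sub_trunc_mem n g))) ?_
  exact sum_mem fun w _ => Submodule.smul_mem _ _ (key _ w rfl)

/-- The dimension at each precision is at least the number of normal words. -/
theorem card_normalLT_le_truncDim (hπ : π 0 = 0) (ha : a ≠ 0) (hov : π a ≠ a ∨ q ≠ 0)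
    {f : NCPowerSeries d} (hf : f ∈ orderGE d (q + 3)) (n : ℕ) :
    (normalLT (leadWord π a q) n).card ≤ truncDim f n := by
  -- Each condition fails for finitely many `s` only, so some `s` satisfies both; it may depend on
  -- `n`.
  obtain ⟨s, hs, hs'⟩ := ((eventually_truncDim_le f (modelPotential π q) n).and
    ((normalSpans_modelPotential (q := q) hπ ha n).eventually f)).exists
  rw [← hs'.truncDim_eq hπ ha hov (add_mem hf (Submodule.smul_mem _ s modelPotential_mem))]
  exact hs

end

/-! ### Cubic growth and the generating series. -/

theorem mem_orderGE_of_order_eq {f : NCPowerSeries d} {k : ℕ} (h : f.order = (k : ℕ∞)) :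
    f ∈ orderGE d k := by
  intro w hw
  by_contra hne
  have h1 : f.order ≤ (w.length : ℕ∞) := iInf₂_le w hne
  rw [h, Nat.cast_le] at h1
  omega

theorem replicate_append_inj {l : Fin d} {x x' : ℕ} {u u' : List (Fin d)} (hu : ∀ v, u ≠ l :: v)
    (hu' : ∀ v, u' ≠ l :: v) (h : List.replicate x l ++ u = List.replicate x' l ++ u') :
    x = x' ∧ u = u' := by
  induction x generalizing x' with
  | zero =>
    cases x' with
    | zero => exact ⟨rfl, h⟩
    | succ x' => exact absurd h (hu _)
  | succ x ih =>
    cases x' with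
    | zero => exact absurd h.symm (hu' _)
    | succ x' =>
      simp only [List.replicate_succ, List.cons_append, List.cons.injEq, true_and] at h
      exact ⟨congrArg _ (ih h).1, (ih h).2⟩

/-- Otherwise `m^(3 - r)` would tend to infinity while bounded by `c * 4 ^ r`. -/
theorem three_le_of_cube_le {D : ℕ → ℕ} (hD : ∀ m, m ^ 3 ≤ D (4 * m)) {r c : ℝ}
    (h : ∀ n : ℕ, (D n : ℝ) ≤ c * (n : ℝ) ^ r) : 3 ≤ r := by
  by_contra! hr
  have hlim := (tendsto_rpow_atTop (sub_pos.mpr hr)).comp tendsto_natCast_atTop_atTop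
  obtain ⟨m, hm, hm1⟩ := ((hlim.eventually_gt_atTop (c * 4 ^ r)).and
    (Filter.eventually_ge_atTop 1)).exists
  have hm0 : (0 : ℝ) < m := by exact_mod_cast hm1
  have h1 : ((m : ℝ)) ^ 3 ≤ c * ((4 * m : ℕ) : ℝ) ^ r :=
    le_trans (by exact_mod_cast hD m) (h (4 * m))
  rw [Nat.cast_mul, Nat.cast_ofNat, Real.mul_rpow (by norm_num) hm0.le, ← mul_assoc] at h1
  have h2 : (m : ℝ) ^ 3 = (m : ℝ) ^ (3 - r) * (m : ℝ) ^ r := by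
    rw [← Real.rpow_add hm0, sub_add_cancel]
    norm_cast
  rw [h2] at h1
  exact absurd (le_of_mul_le_mul_right h1 (Real.rpow_pos_of_pos hm0 r)) (not_le.mpr hm)

section

variable [NeZero d] {π : Equiv.Perm (Fin d)} {a : Fin d} {q : ℕ}

/-- A two-parameter family of normal words that do not start with the letter `0` makes the number
of normal words grow cubically. -/
theorem cube_le_card_normalLT (hπ : π 0 = 0) (ha : a ≠ 0) {u : ℕ → ℕ → List (Fin d)}
    (hu : ∀ y z, IsNormal (leadWord π a q) (u y z)) (hhead : ∀ y z v, u y z ≠ 0 :: v)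
    (hinj : ∀ y z y' z', u y z = u y' z' → y = y' ∧ z = z')
    (hlen : ∀ y z, (u y z).length ≤ 2 * y + z) (m : ℕ) :
    m ^ 3 ≤ (normalLT (leadWord π a q) (4 * m)).card := by
  -- A triple `(x, y, z)` gives a word of length at most `x + 2y + z < 4m`.
  let A := Finset.range m ×ˢ Finset.range m ×ˢ Finset.range m
  let φ : ℕ × ℕ × ℕ → List (Fin d) := fun t => List.replicate t.1 0 ++ u t.2.1 t.2.2
  have hA : A.card = m ^ 3 := by
    simp only [A, Finset.card_product, Finset.card_range]
    ring
  rw [← hA]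
  refine Finset.card_le_card_of_injOn φ ?_ ?_
  · rintro ⟨x, y, z⟩ ht
    simp only [A, Finset.mem_coe, Finset.mem_product, Finset.mem_range] at ht
    refine mem_normalLT.mpr ⟨?_, isNormal_replicate_append hπ ha (hu y z) x⟩
    have := hlen y z
    simp only [φ, List.length_append, List.length_replicate]
    omega
  · rintro ⟨x, y, z⟩ - ⟨x', y', z'⟩ - h
    obtain ⟨rfl, hyz⟩ := replicate_append_inj (hhead y z) (hhead y' z') h
    obtain ⟨rfl, rfl⟩ := hinj _ _ _ _ hyz
    rfl

open PowerSeries (X) in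
/-- The generating series of the number of normal words. -/
theorem mk_card_normalLT_eq (hπ : π 0 = 0) (ha : a ≠ 0) (hov : π a ≠ a ∨ q ≠ 0) :
    (PowerSeries.mk fun n => ((normalLT (leadWord π a q) (n + 1)).card : ℚ)) =
      ((1 - X) * (1 - (d : PowerSeries ℚ) * X + (d : PowerSeries ℚ) * X ^ (q + 2) -
        X ^ (q + 3)))⁻¹ := by
  set Z := PowerSeries.mk fun n => ((normalLT (leadWord π a q) (n + 1)).card : ℚ) with hZ
  -- The coefficients of `Z` are shifted by one, hence the exponent `r + 1`. For `n ≤ r` both sides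
  -- vanish, in agreement with truncated subtraction.
  have hshift : ∀ r n : ℕ,
      PowerSeries.coeff n (X ^ (r + 1) * Z) = ((normalLT (leadWord π a q) (n - r)).card : ℚ) := by
    intro r n
    rw [PowerSeries.coeff_X_pow_mul', hZ, PowerSeries.coeff_mk]
    split_ifs with h
    · rw [show n - (r + 1) + 1 = n - r by omega]
    · rw [show n - r = 0 by omega, normalLT_zero, Finset.card_empty, Nat.cast_zero]
  have hcast : ∀ (n : ℕ) (p : PowerSeries ℚ),
      PowerSeries.coeff n ((d : PowerSeries ℚ) * p) = (d : ℚ) * PowerSeries.coeff n p := by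
    intro n p
    rw [← map_natCast (PowerSeries.C (R := ℚ)) d, PowerSeries.coeff_C_mul]
  have hmul : (1 - (d : PowerSeries ℚ) * X + (d : PowerSeries ℚ) * X ^ (q + 2) - X ^ (q + 3)) * Z =
      PowerSeries.mk 1 := by
    ext n
    have e : (1 - (d : PowerSeries ℚ) * X + (d : PowerSeries ℚ) * X ^ (q + 2) - X ^ (q + 3)) * Z =
        Z - (d : PowerSeries ℚ) * (X ^ (0 + 1) * Z) +
          (d : PowerSeries ℚ) * (X ^ (q + 1 + 1) * Z) - X ^ (q + 2 + 1) * Z := by ring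
    -- The recursion concerns words only; the model serves as a potential for which normal words
    -- span.
    have hrec := NormalSpans.card_normalLT_succ hπ ha hov modelPotential_mem
      (normalSpans_modelPotential (q := q) hπ ha (n + 1))
    have hrec' : ((normalLT (leadWord π a q) (n + 1)).card : ℚ) +
        d * (normalLT (leadWord π a q) (n - (q + 1))).card =
        1 + d * (normalLT (leadWord π a q) n).card +
          (normalLT (leadWord π a q) (n - (q + 1) - 1)).card := by exact_mod_cast hrec
    rw [e, map_sub, map_add, map_sub, hcast, hcast, hshift, hshift, hshift, hZ, PowerSeries.coeff_mk, PowerSeries.coeff_mk,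
      Nat.sub_zero, show n - (q + 2) = n - (q + 1) - 1 by omega, Pi.one_apply]
    linarith
  rw [PowerSeries.eq_inv_iff_mul_eq_one (by simp), mul_comm, mul_assoc, hmul, mul_comm]
  exact PowerSeries.mk_one_mul_one_sub_eq_one ℚ

theorem jdim_and_poincareSeries_of_normal (hπ : π 0 = 0) (ha : a ≠ 0) (hov : π a ≠ a ∨ q ≠ 0)
    (hgrowth : ∀ m, m ^ 3 ≤ (normalLT (leadWord π a q) (4 * m)).card)
    {f : NCPowerSeries d} (hf : f ∈ orderGE d (q + 3)) :
    (3 : EReal) ≤ f.Jdim ∧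
    ∀ n : ℕ,
      PowerSeries.coeff n
        ((1 - PowerSeries.X) *
          (1 - (d : PowerSeries ℚ) * PowerSeries.X
            + (d : PowerSeries ℚ) * PowerSeries.X ^ (q + 2) - PowerSeries.X ^ (q + 3)))⁻¹
        ≤ PowerSeries.coeff n f.poincareSeries := by
  have hle : ∀ n, (normalLT (leadWord π a q) n).card ≤ jacDim f n := by
    intro n
    rw [jacDim_eq (orderGE_anti (by omega) hf)]
    exact card_normalLT_le_truncDim hπ ha hov hf n
  constructor
  · refine le_sInf ?_
    rintro _ ⟨r, ⟨c, hc⟩, rfl⟩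
    exact EReal.coe_le_coe_iff.mpr
      (three_le_of_cube_le (fun m => (hgrowth m).trans (hle (4 * m))) hc)
  · intro n
    rw [← mk_card_normalLT_eq hπ ha hov, poincareSeries, PowerSeries.coeff_mk, PowerSeries.coeff_mk]
    exact_mod_cast hle (n + 1)

end

/-! ### Explicit families of normal words. -/

/-- The word `(x₁ x₀)^y x₁^z`. -/
def altWord : ℕ → ℕ → List (Fin 2)
  | 0, z => List.replicate z 1
  | y + 1, z => 1 :: 0 :: altWord y z

theorem altWord_ne_zero_cons (y z : ℕ) (v : List (Fin 2)) : altWord y z ≠ 0 :: v := by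
  cases y with
  | zero => cases z <;> simp [altWord, List.replicate_succ]
  | succ y => simp [altWord]

/-- The leading words start with `110` and `100`, and neither pattern occurs. The exponent `q + 1`
is essential: with exponent `0` the first leading word would be `11`. -/
theorem isNormal_altWord (q y z : ℕ) :
    IsNormal (leadWord (1 : Equiv.Perm (Fin 2)) 1 (q + 1)) (altWord y z) := by
  induction y with
  | zero =>
    intro j hj
    have h0 : (0 : Fin 2) ∈ leadWord (1 : Equiv.Perm (Fin 2)) 1 (q + 1) j := by
      unfold leadWord
      split_ifs <;> simp
    have := List.eq_of_mem_replicate (hj.subset h0)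
    simp at this
  | succ y ih =>
    refine isNormal_cons.mpr ⟨fun j hj => ?_, isNormal_zero_cons rfl (by simp) ih⟩
    by_cases h : j = 0
    · rw [h, leadWord_zero, List.cons_prefix_cons, Equiv.Perm.one_apply, List.cons_prefix_cons] at hj
      exact absurd hj.2.1 (by simp)
    · rw [leadWord_of_ne _ _ _ h, List.cons_prefix_cons, List.replicate_succ, List.cons_prefix_cons,
        List.replicate_succ] at hj
      obtain ⟨v, hv⟩ := hj.2.2
      exact altWord_ne_zero_cons y z _ hv.symm

theorem count_altWord (y z : ℕ) :
    (altWord y z).count 0 = y ∧ (altWord y z).length = 2 * y + z := by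
  induction y with
  | zero => simp [altWord, List.count_replicate]
  | succ y ih =>
    simp only [altWord, List.length_cons, ih.2]
    refine ⟨?_, by omega⟩
    simp [ih.1]

theorem isNormal_replicate_two_append_one (e q y z : ℕ) :
    IsNormal (leadWord (Equiv.swap 1 2 : Equiv.Perm (Fin (e + 3))) 1 q)
      (List.replicate y 2 ++ List.replicate z 1) := by
  have h2 : (2 : Fin (e + 3)) ≠ 0 := by simp [Fin.ext_iff, Nat.mod_eq_of_lt]
  have h12 : (2 : Fin (e + 3)) ≠ 1 := by simp [Fin.ext_iff, Nat.mod_eq_of_lt]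
  -- A property inherited by sublists that every leading word violates: one contains `1` before `2`,
  -- the others have `0` in second position.
  have hp : (List.replicate y (2 : Fin (e + 3)) ++ List.replicate z 1).Pairwise
      (fun u v : Fin (e + 3) => v ≠ 0 ∧ ¬(u = 1 ∧ v = 2)) := by
    rw [List.pairwise_append]
    refine ⟨?_, ?_, ?_⟩
    · simp [List.pairwise_replicate, h2, h12]
    · simp [List.pairwise_replicate, h12.symm]
    · intro u hu v hv
      rw [List.eq_of_mem_replicate hu, List.eq_of_mem_replicate hv]
      simp [h12]
  intro j hj
  have hp' := hp.sublist hj.sublist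
  by_cases h : j = 0
  · rw [h, leadWord_zero, Equiv.swap_apply_left] at hp'
    simp at hp'
  · rw [leadWord_of_ne _ _ _ h, List.replicate_succ] at hp'
    simp at hp'

end NCPowerSeries

end

open NCPowerSeries in
theorem theoremA (d k : ℕ) (hdk : (d = 2 ∧ 4 ≤ k) ∨ (3 ≤ d ∧ 3 ≤ k))
    (f : NCPowerSeries d) (hf : f.order = (k : ℕ∞)) :
    (3 : EReal) ≤ f.Jdim ∧
    ∀ n : ℕ,
      PowerSeries.coeff n
        ((1 - PowerSeries.X) *
          (1 - (d : PowerSeries ℚ) * PowerSeries.X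
            + (d : PowerSeries ℚ) * PowerSeries.X ^ (k - 1) - PowerSeries.X ^ k))⁻¹
        ≤ PowerSeries.coeff n f.poincareSeries := by
  have hf' := mem_orderGE_of_order_eq hf
  rcases hdk with ⟨rfl, hk⟩ | ⟨hd, hk⟩
  · obtain ⟨q, rfl⟩ := Nat.exists_eq_add_of_le' hk
    -- Only one nonzero letter is available, so `π a = a`, and the self-overlap is excluded by `k ≥
    -- 4`.
    refine jdim_and_poincareSeries_of_normal (π := 1) (a := 1) (q := q + 1) rfl (by simp)
      (Or.inr (by simp)) ?_ hf'
    refine cube_le_card_normalLT rfl (by simp) (isNormal_altWord q) altWord_ne_zero_cons ?_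
      fun y z => (count_altWord y z).2.le
    intro y z y' z' h
    have h0 := count_altWord y z
    have h1 := count_altWord y' z'
    rw [h] at h0
    omega
  · obtain ⟨e, rfl⟩ := Nat.exists_eq_add_of_le' hd
    obtain ⟨q, rfl⟩ := Nat.exists_eq_add_of_le' hk
    have h2 : (2 : Fin (e + 3)) ≠ 0 := by simp [Fin.ext_iff, Nat.mod_eq_of_lt]
    have h12 : (2 : Fin (e + 3)) ≠ 1 := by simp [Fin.ext_iff, Nat.mod_eq_of_lt]
    have hπ : (Equiv.swap 1 2 : Equiv.Perm (Fin (e + 3))) 0 = 0 :=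
      Equiv.swap_apply_of_ne_of_ne (by simp) h2.symm
    -- With two nonzero letters, the swap gives `π a ≠ a`, so `k = 3` is allowed.
    refine jdim_and_poincareSeries_of_normal (π := Equiv.swap 1 2) (a := 1) (q := q) hπ (by simp)
      (Or.inl (by rw [Equiv.swap_apply_left]; exact h12)) ?_ hf'
    refine cube_le_card_normalLT (u := fun y z => List.replicate y 2 ++ List.replicate z 1) hπ
      (by simp) (isNormal_replicate_two_append_one e q) ?_ ?_ fun y z => by simp; omega
    · intro y z v h
      have h0 : (0 : Fin (e + 3)) ∈ List.replicate y 2 ++ List.replicate z 1 := by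
        rw [h]
        exact List.mem_cons_self
      simp [h2.symm] at h0
    · intro y z y' z' h
      have hc := congrArg (List.count 2) h
      have hl := congrArg List.length h
      simp [List.count_replicate, h12.symm] at hc hl
      omega
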